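/- **Proposition C.2 (boundary case, time domain to spectral domain).** Let $\{X_n\}_{n\in\mathbb Z}$ be a real-valued, zero-mean, second-order stationary series with autocovariance function $\gamma_X(h)=\mathbb E X_hX_0$. Let $\lambda_0\in(0,\pi)$, $d\in(0,1/2)$, $c_\gamma>0$, $\phi=(\tfrac12-d)\pi$, and suppose that $X$ exhibits cyclical long memory (CLM) in the time domain, that is, $$\gamma_X(h)=\bigl(c_\gamma\cos(\lambda_0h+\phi)+R_\gamma(h)\bigr)h^{2d-1},\qquad h=1,2,\dots,$$ with $R_\gamma(x)\to0$ as $x\to\infty$, where for every integer $h\ge1$ $$R_\gamma(h)=L_{1,\gamma}(h)\cos(\lambda_0h)\,h^{-2\varepsilon}+\xi L_{2,\gamma}(h)\sin(\lambda_0h)\,h^{-2\varepsilon}.$$ Here $\varepsilon\in(0,d)$, $\xi\in\{1,-1\}$, and $L_{1,\gamma},L_{2,\gamma}:(0,\infty)\to(0,\infty)$ are quasi-monotone slowly varying functions at $+\infty$ such that, as $x\to\infty$, $L_{1,\gamma}(x)\to b_1\in(0,\infty)$ and $\xi L_{2,\gamma}(x)\to b_2\in\mathbb R$, where $$b_2=0\quad\text{or}\quad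 \frac{b_1}{b_2}\in\bigl(-\tan(\pi(d-\varepsilon)),\tan(\pi(d-\varepsilon))\bigr).$$ (A slowly varying $L$ is quasi-monotone if it is of bounded variation on each interval $(0,x]$, $x>0$, and $\int_0^xu^\delta|dL(u)|=O(x^\delta L(x))$ as $x\to\infty$ for some $\delta>0$, where $|dL|$ is the measure given by the total variation function of $L$.) Then $X$ exhibits CLM in the spectral domain with the same $\lambda_0,d$ and with $$c_f^-=0,\qquad c_f^+=\frac{c_\gamma}{2\pi}\Gamma(2d)\sin(2\pi d).$$ That is, $c_f^+>0$, and $X$ has a spectral density $f_X\ge 0$, integrable on $(-\pi,\pi)$ with $\gamma_X(h)=\int_{-\pi}^{\pi}e^{ih\lambda}f_X(\lambda)\,d\lambda$ for all $h\in\mathbb Z$, that (in a suitable version) satisfies $$f_X(\lambda)=\begin{cases}\bigl(c_f^-+R_f^-(\lambda_0-\lambda)\bigr)(\lambda_0-\lambda)^{-2d},&0<\lambda<\lambda_0,\\ \bigl(c_f^++R_f^+(\lambda-\lambda_0)\bigr)(\lambda-\lambda_0)^{-2d},&\lambda_0<\lambda<\pi,\end{cases}$$ for some functions $R_f^\pm:(0,\infty)\to[-c_f^\pm,\infty)$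 with $R_f^\pm(x)\to0$ as $x\to0^+$. -/

import Mathlib

open Set Filter Topology MeasureTheory

noncomputable section

namespace CLM

/-! ### Second-order stationary series, autocovariance, spectral density -/

/-- The real-valued series `X` is second-order stationary with zero mean: finite second moments,
`E X_n = 0`, and `E X_{n+h} X_n` does not depend on `n`. -/
structure IsSecondOrderStationary {Ω : Type*} [MeasurableSpace Ω] (P : Measure Ω)
    (X : ℤ → Ω → ℝ) : Prop where
  memLp : ∀ n, MemLp (X n) 2 P
  mean_zero : ∀ n, ∫ ω, X n ω ∂P = 0
  shift : ∀ n h : ℤ, ∫ ω, X (n + h) ω * X n ω ∂P = ∫ ω, X h ω * X 0 ω ∂P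

/-- The autocovariance function `γ_X(h) = E X_h X_0`. -/
def acvf {Ω : Type*} [MeasurableSpace Ω] (P : Measure Ω) (X : ℤ → Ω → ℝ) (h : ℤ) : ℝ :=
  ∫ ω, X h ω * X 0 ω ∂P

/-- `f` is (a version of) the spectral density on `(-π, π)` belonging to the autocovariances `γ`:
it is nonnegative and integrable, and `γ(h) = ∫_{-π}^{π} e^{ihλ} f(λ) dλ` for every integer `h`. -/
structure IsSpectralDensity (γ : ℤ → ℝ) (f : ℝ → ℝ) : Prop where
  nonneg : ∀ x ∈ Ioo (-Real.pi) Real.pi, 0 ≤ f x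
  integrable : IntegrableOn f (Ioo (-Real.pi) Real.pi)
  fourier : ∀ h : ℤ, (γ h : ℂ) =
    ∫ x in Ioo (-Real.pi) Real.pi, Complex.exp (Complex.I * (h : ℂ) * (x : ℂ)) * (f x : ℂ)

/-! ### Cyclical long memory (CLM) -/

/-- CLM in the spectral domain, with cyclical frequency `lam₀`, memory parameter `d` and constants
`cm = c_f^-`, `cp = c_f^+`: the series has a spectral density `f` with
`f(λ) = (c_f^- + R_f^-(λ₀ - λ)) (λ₀ - λ)^{-2d}` for `0 < λ < λ₀` and
`f(λ) = (c_f^+ + R_f^+(λ - λ₀)) (λ - λ₀)^{-2d}` for `λ₀ < λ < π`, where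
`R_f^± : (0, ∞) → [-c_f^±, ∞)` tend to `0` at `0+`. -/
def IsSpectralCLM {Ω : Type*} [MeasurableSpace Ω] (P : Measure Ω) (X : ℤ → Ω → ℝ)
    (lam₀ d cm cp : ℝ) : Prop :=
  lam₀ ∈ Ioo 0 Real.pi ∧ d ∈ Ioo (0 : ℝ) (1 / 2) ∧ 0 ≤ cm ∧ 0 ≤ cp ∧ 0 < cp + cm ∧
  ∃ f : ℝ → ℝ, IsSpectralDensity (acvf P X) f ∧
  ∃ Rm Rp : ℝ → ℝ,
    (∀ x, 0 < x → -cm ≤ Rm x) ∧ (∀ x, 0 < x → -cp ≤ Rp x) ∧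
    Tendsto Rm (𝓝[>] 0) (𝓝 0) ∧ Tendsto Rp (𝓝[>] 0) (𝓝 0) ∧
    (∀ x, 0 < x → x < lam₀ → f x = (cm + Rm (lam₀ - x)) * (lam₀ - x) ^ (-2 * d)) ∧
    (∀ x, lam₀ < x → x < Real.pi → f x = (cp + Rp (x - lam₀)) * (x - lam₀) ^ (-2 * d))

/-- CLM in the time domain, with cyclical frequency `lam₀`, memory parameter `d`, constant
`cγ`, cyclical phase `φ` and remainder function `R`:
`γ_X(h) = (cγ cos(λ₀ h + φ) + R(h)) h^{2d-1}` for `h = 1, 2, …`, with `R(x) → 0` as `x → ∞`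
(at `h = 0` the factor `h^{2d-1}` is infinite and the formula imposes nothing). -/
structure IsTimeCLM {Ω : Type*} [MeasurableSpace Ω] (P : Measure Ω) (X : ℤ → Ω → ℝ)
    (lam₀ d cγ φ : ℝ) (R : ℝ → ℝ) : Prop where
  freq : lam₀ ∈ Ioo 0 Real.pi
  memory : d ∈ Ioo (0 : ℝ) (1 / 2)
  const_pos : 0 < cγ
  phase : φ ∈ Icc (-((1 / 2 - d) * Real.pi)) ((1 / 2 - d) * Real.pi)
  remainder : Tendsto R atTop (𝓝 0)
  acvf_eq : ∀ h : ℕ, 1 ≤ h →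
    acvf P X (h : ℤ) = (cγ * Real.cos (lam₀ * h + φ) + R h) * (h : ℝ) ^ (2 * d - 1)

/-! ### Quasi-monotone slowly varying functions

Functions on `(0, ∞)` are represented by functions on `ℝ` of which only the values on `(0, ∞)`
are used. -/

/-- `L : (0, ∞) → (0, ∞)` is slowly varying at infinity. -/
def IsSlowlyVarying (L : ℝ → ℝ) : Prop :=
  (∀ x, 0 < x → 0 < L x) ∧ ∀ a, 0 < a → Tendsto (fun x => L (a * x) / L x) atTop (𝓝 1)

/-- `L` has bounded variation on every interval `(0, x]`; as the value at `0` does not matter for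
this, it means bounded variation on every compact interval of `[0, ∞)`. -/
def IsLocallyBV (L : ℝ → ℝ) : Prop := ∀ x, BoundedVariationOn L (Ioc 0 x)

theorem IsLocallyBV.monotone_variation {L : ℝ → ℝ} (hL : IsLocallyBV L) :
    Monotone (fun x => (eVariationOn L (Ioc 0 x)).toReal) := fun _ y hxy =>
  ENNReal.toReal_mono (hL y) (eVariationOn.mono L (Ioc_subset_Ioc_right hxy))

/-- The measure `|dL|` on `ℝ`: the Lebesgue-Stieltjes measure of the total variation function
`x ↦ Var(L; (0, x])`. It is carried by `(0, ∞)`. -/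
def variationMeasure (L : ℝ → ℝ) (hL : IsLocallyBV L) : Measure ℝ :=
  hL.monotone_variation.stieltjesFunction.measure

/-- `L` is a quasi-monotone slowly varying function at infinity: it is slowly varying, locally of
bounded variation, and `∫_0^x u^δ |dL(u)| = O(x^δ L(x))` as `x → ∞` for some `δ > 0`. -/
structure IsQuasiMonotoneSV (L : ℝ → ℝ) : Prop where
  slow : IsSlowlyVarying L
  bv : IsLocallyBV L
  quasi : ∃ δ : ℝ, 0 < δ ∧
    (fun x : ℝ => ∫ u in Ioc 0 x, u ^ δ ∂(variationMeasure L bv))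
      =O[atTop] (fun x : ℝ => x ^ δ * L x)

end CLM

end

/-!
The autocovariances are `γ(h) = Re (a(h) e^{iλ₀h})` with
`a(h) = c_γ e^{iφ} h^{2d-1} + (L₁(h) - iξL₂(h)) h^{2d-1-2ε}`, so that formally
`2π f(λ) = γ(0) + Re G(e^{i(λ₀+λ)}) + Re G(e^{i(λ₀-λ)})`, where `G(w) = ∑_{h ≥ 1} a(h) w^h`. This
`f` is shown to be the spectral density, and its behaviour at `λ₀` is that of `G` at `w = 1`.

*Convergence.* Quasi-monotonicity bounds the variation of `L₁`, `L₂` over the dyadic blocks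
`[N, 2N]` (`CLM.IsQuasiMonotoneSV.exists_dyadic_variation_le`). Hence `L(h) h^{-β}` is `O(N^{-β})`
together with its variation on `[N, ∞)` (`CLM.PowerBV`). For such coefficients summation by parts
shows that the partial sums of `∑ a(h) w^h` converge for `|w| = 1`, `w ≠ 1`, and are
`O(|1 - w|^{β-1})` uniformly (`CLM.PowerBV.exists_norm_partialSum_le`).

*Spectral density.* The uniform bound is integrable over the circle, so dominated convergence
identifies the Fourier coefficients of `f`. Where the Fourier series converges, its sum is the limit
of the Fejér means, which are the second moments of `n^{-1/2} ∑_{j<n} X_j e^{ijλ}`; thus `f ≥ 0`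
pointwise (`CLM.IsSecondOrderStationary.nonneg_of_tendsto`). In particular `f ≥ 0` comes from the
positive definiteness of `γ`.

*Singularity.* With `s = 2d`, Gautschi's inequality
`(h+1)^{s-1} ≤ Γ(h+s)/h! ≤ h^{s-1}` makes the difference between `h^{s-1}` and `Γ(s)` times the
binomial coefficients of `(1 - w)^{-s}` absolutely summable. The binomial series may be summed on
the unit circle by Abel's limit theorem, so `∑ h^{s-1} w^h = Γ(s) (1 - w)^{-s} + O(1)`
(`CLM.norm_oscSum_rpow_sub_le`). For `w = e^{±ix}` this is `x^{-s} Γ(s) e^{±iπd}` to leading order,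
and the two one-sided limits at `λ₀` are `c_γ Γ(2d) cos(φ ± πd) / (2π)`. At the boundary phase
`φ = π/2 - πd` the cosine is `0` on the left and `sin(2πd)` on the right. The part of `a` with
`L₁`, `L₂` contributes only `O(x^{-2d+2ε})`.
-/

noncomputable section

namespace CLM


/-! ### Sequences of power-bounded variation -/

/-- The sequence `a` on the positive integers is of size `O(N^{-β})`, and so is its variation on
`[N, ∞)`. The value `a 0` plays no role. -/
def PowerBV (β : ℝ) (a : ℕ → ℂ) : Prop :=
  ∃ C : ℝ, 0 ≤ C ∧ ∀ N : ℕ, 1 ≤ N → ‖a N‖ ≤ C * (N : ℝ) ^ (-β) ∧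
    ∀ M : ℕ, ∑ h ∈ Finset.Ico N M, ‖a (h + 1) - a h‖ ≤ C * (N : ℝ) ^ (-β)

theorem PowerBV.add {β : ℝ} {a b : ℕ → ℂ} (ha : PowerBV β a) (hb : PowerBV β b) :
    PowerBV β (fun n => a n + b n) := by
  obtain ⟨C, hC, h⟩ := ha
  obtain ⟨D, hD, k⟩ := hb
  refine ⟨C + D, by positivity, fun N hN => ⟨?_, fun M => ?_⟩⟩
  · rw [add_mul]
    exact (norm_add_le _ _).trans (add_le_add (h N hN).1 (k N hN).1)
  · rw [add_mul]
    refine le_trans ?_ (add_le_add ((h N hN).2 M) ((k N hN).2 M))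
    rw [← Finset.sum_add_distrib]
    refine Finset.sum_le_sum fun i _ => ?_
    rw [add_sub_add_comm]
    exact norm_add_le _ _

theorem PowerBV.const_mul {β : ℝ} {a : ℕ → ℂ} (ha : PowerBV β a) (c : ℂ) :
    PowerBV β (fun n => c * a n) := by
  obtain ⟨C, hC, h⟩ := ha
  refine ⟨‖c‖ * C, by positivity, fun N hN => ⟨?_, fun M => ?_⟩⟩
  · rw [norm_mul, mul_assoc]
    exact mul_le_mul_of_nonneg_left (h N hN).1 (norm_nonneg _)
  · simp only [← mul_sub, norm_mul, ← Finset.mul_sum]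
    rw [mul_assoc]
    exact mul_le_mul_of_nonneg_left ((h N hN).2 M) (norm_nonneg _)

theorem PowerBV.mono {β β' : ℝ} {a : ℕ → ℂ} (ha : PowerBV β a) (hβ : β' ≤ β) :
    PowerBV β' a := by
  obtain ⟨C, hC, h⟩ := ha
  refine ⟨C, hC, fun N hN => ?_⟩
  have : C * (N : ℝ) ^ (-β) ≤ C * (N : ℝ) ^ (-β') :=
    mul_le_mul_of_nonneg_left
      (Real.rpow_le_rpow_of_exponent_le (by exact_mod_cast hN) (by linarith)) hC
  exact ⟨(h N hN).1.trans this, fun M => ((h N hN).2 M).trans this⟩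

theorem sum_Ico_mul_pow_by_parts (a : ℕ → ℂ) (w : ℂ) {N M : ℕ} (hNM : N ≤ M) :
    (1 - w) * ∑ h ∈ Finset.Ico N M, a h * w ^ h
      = a N * w ^ N - a M * w ^ M + ∑ h ∈ Finset.Ico N M, (a (h + 1) - a h) * w ^ (h + 1) := by
  induction M, hNM using Nat.le_induction with
  | base => simp
  | succ M hM ih =>
    rw [Finset.sum_Ico_succ_top hM, Finset.sum_Ico_succ_top hM, mul_add, ih]
    ring

theorem norm_sum_Ico_mul_pow_le {a : ℕ → ℂ} {w : ℂ} (hw : ‖w‖ = 1) {K : ℝ} {N M : ℕ}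
    (hNM : N ≤ M) (hN : ‖a N‖ ≤ K) (hM : ‖a M‖ ≤ K)
    (hV : ∑ h ∈ Finset.Ico N M, ‖a (h + 1) - a h‖ ≤ K) :
    ‖1 - w‖ * ‖∑ h ∈ Finset.Ico N M, a h * w ^ h‖ ≤ 3 * K := by
  rw [← norm_mul, sum_Ico_mul_pow_by_parts a w hNM]
  have h1 : ‖∑ h ∈ Finset.Ico N M, (a (h + 1) - a h) * w ^ (h + 1)‖ ≤ K := by
    refine (norm_sum_le _ _).trans (le_trans (le_of_eq ?_) hV)
    exact Finset.sum_congr rfl fun i _ => by simp [hw]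
  have h2 : ‖a N * w ^ N - a M * w ^ M‖ ≤ K + K := by
    refine (norm_sub_le _ _).trans ?_
    simp only [norm_mul, norm_pow, hw, one_pow, mul_one]
    exact add_le_add hN hM
  linarith [norm_add_le (a N * w ^ N - a M * w ^ M)
    (∑ h ∈ Finset.Ico N M, (a (h + 1) - a h) * w ^ (h + 1))]

theorem PowerBV.exists_norm_sum_Ico_le {β : ℝ} {a : ℕ → ℂ} (ha : PowerBV β a) (hβ : 0 ≤ β) :
    ∃ C : ℝ, 0 ≤ C ∧ ∀ w : ℂ, ‖w‖ = 1 → ∀ N M : ℕ, 1 ≤ N →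
      ‖1 - w‖ * ‖∑ h ∈ Finset.Ico N M, a h * w ^ h‖ ≤ C * (N : ℝ) ^ (-β) := by
  obtain ⟨C, hC, h⟩ := ha
  refine ⟨3 * C, by positivity, fun w hw N M hN => ?_⟩
  have hN0 : (0 : ℝ) < N := by exact_mod_cast hN
  rcases le_total M N with hMN | hNM
  · rw [Finset.Ico_eq_empty_of_le hMN]
    simp only [Finset.sum_empty, norm_zero, mul_zero]
    positivity
  · rw [mul_assoc]
    refine norm_sum_Ico_mul_pow_le hw hNM (h N hN).1 ?_ ((h N hN).2 M)
    refine (h M (hN.trans hNM)).1.trans (mul_le_mul_of_nonneg_left ?_ hC)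
    exact Real.rpow_le_rpow_of_nonpos hN0 (by exact_mod_cast hNM) (by linarith)

/-- The sum `∑_{h ≥ 1} a(h) w^h`, as the limit of its partial sums. -/
def oscSum (a : ℕ → ℂ) (w : ℂ) : ℂ :=
  limUnder atTop fun M : ℕ => ∑ h ∈ Finset.Ico 1 M, a h * w ^ h

theorem oscSum_eq {a : ℕ → ℂ} {w l : ℂ}
    (h : Tendsto (fun M : ℕ => ∑ h ∈ Finset.Ico 1 M, a h * w ^ h) atTop (𝓝 l)) :
    oscSum a w = l := h.limUnder_eq

theorem PowerBV.tendsto_oscSum {β : ℝ} {a : ℕ → ℂ} (ha : PowerBV β a) (hβ : 0 < β) {w : ℂ}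
    (hw : ‖w‖ = 1) (hw1 : w ≠ 1) :
    Tendsto (fun M : ℕ => ∑ h ∈ Finset.Ico 1 M, a h * w ^ h) atTop (𝓝 (oscSum a w)) := by
  apply CauchySeq.tendsto_limUnder
  obtain ⟨C, hC, h⟩ := ha.exists_norm_sum_Ico_le hβ.le
  have hu : 0 < ‖1 - w‖ := norm_pos_iff.2 (sub_ne_zero.2 hw1.symm)
  have hlim : Tendsto (fun N : ℕ => C * ((N + 1 : ℕ) : ℝ) ^ (-β) / ‖1 - w‖) atTop (𝓝 0) := by
    have h1 := (tendsto_rpow_neg_atTop hβ).comp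
      (tendsto_natCast_atTop_atTop.comp (tendsto_add_atTop_nat 1))
    simpa using (h1.const_mul C).div_const ‖1 - w‖
  -- `Ico 1 M` is empty for `M = 0` as for `M = 1`, so shifting the index loses nothing
  rw [← cauchySeq_shift 1]
  refine cauchySeq_of_le_tendsto_0' _ (fun N M hNM => ?_) hlim
  rw [dist_comm, dist_eq_norm, ← Finset.sum_Ico_consecutive _ (by omega : 1 ≤ N + 1)
    (by omega : N + 1 ≤ M + 1), add_sub_cancel_left, le_div_iff₀ hu, mul_comm]
  exact h w hw (N + 1) (M + 1) (by omega)

theorem sum_Ico_rpow_neg_le {β : ℝ} (hβ0 : 0 ≤ β) (hβ1 : β < 1) (n : ℕ) :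
    ∑ h ∈ Finset.Ico 1 (n + 1), (h : ℝ) ^ (-β) ≤ (n : ℝ) ^ (1 - β) / (1 - β) := by
  have hp : 0 < 1 - β := by linarith
  induction n with
  | zero => simp [Real.zero_rpow hp.ne']
  | succ n ih =>
    rw [Finset.sum_Ico_succ_top (by omega)]
    refine (add_le_add_left ih _).trans ?_
    rw [le_div_iff₀ hp, add_mul, div_mul_cancel₀ _ hp.ne']
    have hx : (0 : ℝ) < ((n + 1 : ℕ) : ℝ) := by positivity
    have hb := _root_.rpow_one_add_le_one_add_mul_self (s := -1 / ((n + 1 : ℕ) : ℝ)) (p := 1 - β)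
      (by rw [le_div_iff₀ hx]; push_cast; linarith [(n.cast_nonneg : (0 : ℝ) ≤ n)]) hp.le
      (by linarith)
    have hn : (n : ℝ) = ((n + 1 : ℕ) : ℝ) * (1 + -1 / ((n + 1 : ℕ) : ℝ)) := by
      field_simp; push_cast; ring
    have h0 : 0 ≤ 1 + -1 / ((n + 1 : ℕ) : ℝ) := by
      by_contra hneg
      push Not at hneg
      nlinarith [(n.cast_nonneg : (0 : ℝ) ≤ n)]
    have hpow : ((n + 1 : ℕ) : ℝ) ^ (1 - β) = ((n + 1 : ℕ) : ℝ) * ((n + 1 : ℕ) : ℝ) ^ (-β) := by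
      rw [sub_eq_add_neg, Real.rpow_add hx, Real.rpow_one]
    calc (n : ℝ) ^ (1 - β) + ((n + 1 : ℕ) : ℝ) ^ (-β) * (1 - β)
        = ((n + 1 : ℕ) : ℝ) ^ (1 - β) * (1 + -1 / ((n + 1 : ℕ) : ℝ)) ^ (1 - β)
          + ((n + 1 : ℕ) : ℝ) ^ (-β) * (1 - β) := by
          rw [← Real.mul_rpow hx.le h0, ← hn]
      _ ≤ ((n + 1 : ℕ) : ℝ) ^ (1 - β) * (1 + (1 - β) * (-1 / ((n + 1 : ℕ) : ℝ)))
          + ((n + 1 : ℕ) : ℝ) ^ (-β) * (1 - β) := by gcongr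
      _ = ((n + 1 : ℕ) : ℝ) ^ (1 - β) := by
          rw [hpow]; field_simp; ring

/-- The partial sums of `∑ a(h) w^h` are `O(|1 - w|^{β - 1})` uniformly: the terms up to
`N ≈ 1 / |1 - w|` are estimated by their size, the others by summation by parts. -/
theorem PowerBV.exists_norm_partialSum_le {β : ℝ} {a : ℕ → ℂ} (ha : PowerBV β a) (hβ0 : 0 < β)
    (hβ1 : β < 1) :
    ∃ C : ℝ, 0 ≤ C ∧ ∀ w : ℂ, ‖w‖ = 1 → w ≠ 1 → ∀ M : ℕ,
      ‖∑ h ∈ Finset.Ico 1 M, a h * w ^ h‖ ≤ C * ‖1 - w‖ ^ (β - 1) := by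
  obtain ⟨C, hC, hCb⟩ := ha.exists_norm_sum_Ico_le hβ0.le
  obtain ⟨D, hD, hDb⟩ := ha
  have hp : 0 < 1 - β := by linarith
  refine ⟨D * (3 ^ (1 - β) / (1 - β)) + C, by positivity, fun w hw hw1 M => ?_⟩
  set u := ‖1 - w‖ with hu_def
  have hu : 0 < u := norm_pos_iff.2 (sub_ne_zero.2 hw1.symm)
  have hu2 : u ≤ 2 := by
    have := norm_sub_le 1 w
    rw [hw, norm_one] at this
    linarith
  set n := ⌈1 / u⌉₊ with hn
  have hn1 : 1 / u ≤ n := Nat.le_ceil _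
  have hn3 : (n : ℝ) ≤ 3 / u := by
    have h1 : (n : ℝ) < 1 / u + 1 := Nat.ceil_lt_add_one (by positivity)
    have h2 : (1 : ℝ) ≤ 2 / u := by rw [le_div_iff₀ hu]; linarith
    have h3 : 3 / u = 1 / u + 2 / u := by ring
    linarith
  have hnpos : 1 ≤ n := Nat.one_le_ceil_iff.2 (by positivity)
  have head : ∀ m ≤ n + 1, ‖∑ h ∈ Finset.Ico 1 m, a h * w ^ h‖
      ≤ D * (3 ^ (1 - β) / (1 - β)) * u ^ (β - 1) := by
    intro m hm
    calc ‖∑ h ∈ Finset.Ico 1 m, a h * w ^ h‖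
        ≤ ∑ h ∈ Finset.Ico 1 m, D * (h : ℝ) ^ (-β) := by
          refine norm_sum_le_of_le _ fun i hi => ?_
          rw [norm_mul, norm_pow, hw, one_pow, mul_one]
          exact (hDb i (Finset.mem_Ico.1 hi).1).1
      _ ≤ ∑ h ∈ Finset.Ico 1 (n + 1), D * (h : ℝ) ^ (-β) :=
          Finset.sum_le_sum_of_subset_of_nonneg (Finset.Ico_subset_Ico_right hm)
            fun _ _ _ => by positivity
      _ ≤ D * ((n : ℝ) ^ (1 - β) / (1 - β)) := by
          rw [← Finset.mul_sum]
          exact mul_le_mul_of_nonneg_left (sum_Ico_rpow_neg_le hβ0.le hβ1 n) hD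
      _ ≤ D * ((3 / u) ^ (1 - β) / (1 - β)) := by gcongr
      _ = D * (3 ^ (1 - β) / (1 - β)) * u ^ (β - 1) := by
          rw [Real.div_rpow (by norm_num) hu.le, ← neg_sub 1 β, Real.rpow_neg hu.le]
          ring
  have htail0 : 0 ≤ C * u ^ (β - 1) := by positivity
  rw [add_mul]
  rcases le_total M (n + 1) with hM | hM
  · linarith [head M hM]
  · have tail : ‖∑ h ∈ Finset.Ico (n + 1) M, a h * w ^ h‖ ≤ C * u ^ (β - 1) := by
      have h1 := hCb w hw (n + 1) M (by omega)
      have h2 : ((n + 1 : ℕ) : ℝ) ^ (-β) ≤ (1 / u) ^ (-β) :=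
        Real.rpow_le_rpow_of_nonpos (by positivity) (by push_cast; linarith) (by linarith)
      have h3 : (1 / u) ^ (-β) = u * u ^ (β - 1) := by
        rw [one_div, Real.inv_rpow hu.le, ← Real.rpow_neg hu.le, neg_neg, Real.rpow_sub_one hu.ne']
        field_simp
      have h4 : u * ‖∑ h ∈ Finset.Ico (n + 1) M, a h * w ^ h‖ ≤ u * (C * u ^ (β - 1)) := by
        refine h1.trans ((mul_le_mul_of_nonneg_left h2 hC).trans (le_of_eq ?_))
        rw [h3]; ring
      exact le_of_mul_le_mul_left h4 hu
    rw [← Finset.sum_Ico_consecutive _ (by omega : 1 ≤ n + 1) hM]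
    exact (norm_add_le _ _).trans (add_le_add (head _ le_rfl) tail)

theorem PowerBV.exists_norm_oscSum_le {β : ℝ} {a : ℕ → ℂ} (ha : PowerBV β a) (hβ0 : 0 < β)
    (hβ1 : β < 1) :
    ∃ C : ℝ, 0 ≤ C ∧ ∀ w : ℂ, ‖w‖ = 1 → w ≠ 1 → ‖oscSum a w‖ ≤ C * ‖1 - w‖ ^ (β - 1) := by
  obtain ⟨C, hC, h⟩ := ha.exists_norm_partialSum_le hβ0 hβ1
  exact ⟨C, hC, fun w hw hw1 =>
    le_of_tendsto (ha.tendsto_oscSum hβ0 hw hw1).norm (Eventually.of_forall (h w hw hw1))⟩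

/-! ### Slowly varying coefficients -/

theorem sum_Ico_dyadic_le {v : ℕ → ℝ} (hv : ∀ h, 0 ≤ v h) {β B : ℝ} (hβ : 0 < β)
    (hB : ∀ N : ℕ, 1 ≤ N → ∑ h ∈ Finset.Ico N (2 * N), v h ≤ B) {N : ℕ} (hN : 1 ≤ N) (k : ℕ) :
    ∑ h ∈ Finset.Ico N (2 ^ k * N), v h * (h : ℝ) ^ (-β)
      ≤ B * (N : ℝ) ^ (-β) * ∑ i ∈ Finset.range k, ((2 : ℝ) ^ (-β)) ^ i := by
  induction k with
  | zero => simp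
  | succ k ih =>
    have hkN : 1 ≤ 2 ^ k * N := Nat.one_le_iff_ne_zero.2 (by positivity)
    have hle : N ≤ 2 ^ k * N := Nat.le_mul_of_pos_left _ (by positivity)
    rw [Finset.sum_range_succ, mul_add, ← Finset.sum_Ico_consecutive _ hle
      (by rw [pow_succ]; nlinarith : 2 ^ k * N ≤ 2 ^ (k + 1) * N)]
    refine add_le_add ih ?_
    have hpos : (0 : ℝ) < ((2 ^ k * N : ℕ) : ℝ) := by exact_mod_cast hkN
    calc ∑ h ∈ Finset.Ico (2 ^ k * N) (2 ^ (k + 1) * N), v h * (h : ℝ) ^ (-β)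
        ≤ ∑ h ∈ Finset.Ico (2 ^ k * N) (2 * (2 ^ k * N)), v h * ((2 ^ k * N : ℕ) : ℝ) ^ (-β) := by
          rw [pow_succ, mul_comm (2 ^ k) 2, mul_assoc]
          refine Finset.sum_le_sum fun i hi => mul_le_mul_of_nonneg_left ?_ (hv i)
          exact Real.rpow_le_rpow_of_nonpos hpos (by exact_mod_cast (Finset.mem_Ico.1 hi).1)
            (by linarith)
      _ ≤ B * ((2 ^ k * N : ℕ) : ℝ) ^ (-β) := by
          rw [← Finset.sum_mul]
          exact mul_le_mul_of_nonneg_right (hB _ hkN) (by positivity)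
      _ = B * (N : ℝ) ^ (-β) * ((2 : ℝ) ^ (-β)) ^ k := by
          push_cast
          rw [Real.mul_rpow (by positivity) (by positivity), ← Real.rpow_natCast,
            ← Real.rpow_natCast, ← Real.rpow_mul (by norm_num), ← Real.rpow_mul (by norm_num)]
          ring_nf

/-- A bounded factor whose variation over the dyadic blocks is bounded may be put in front of
`h^{-β}`. -/
theorem PowerBV.of_dyadic {l : ℕ → ℂ} {β A B : ℝ} (hβ : 0 < β) (hA : ∀ N : ℕ, 1 ≤ N → ‖l N‖ ≤ A)
    (hB : ∀ N : ℕ, 1 ≤ N → ∑ h ∈ Finset.Ico N (2 * N), ‖l (h + 1) - l h‖ ≤ B) :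
    PowerBV β (fun h => l h * (((h : ℝ) ^ (-β) : ℝ) : ℂ)) := by
  have hA0 : 0 ≤ A := (norm_nonneg _).trans (hA 1 le_rfl)
  have hB0 : 0 ≤ B := (Finset.sum_nonneg fun _ _ => norm_nonneg _).trans (hB 1 le_rfl)
  have hq0 : (0 : ℝ) ≤ 2 ^ (-β) := by positivity
  have hq1 : (2 : ℝ) ^ (-β) < 1 := Real.rpow_lt_one_of_one_lt_of_neg (by norm_num) (by linarith)
  have hq : 0 ≤ (1 - (2 : ℝ) ^ (-β))⁻¹ := inv_nonneg.2 (by linarith)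
  have hanti : ∀ h : ℕ, 1 ≤ h → ((h + 1 : ℕ) : ℝ) ^ (-β) ≤ (h : ℝ) ^ (-β) := fun h hh =>
    Real.rpow_le_rpow_of_nonpos (by exact_mod_cast hh) (by push_cast; linarith) (by linarith)
  refine ⟨A + B * (1 - (2 : ℝ) ^ (-β))⁻¹, by positivity, fun N hN => ⟨?_, fun M => ?_⟩⟩
  · rw [norm_mul, Complex.norm_real, Real.norm_of_nonneg (by positivity), add_mul]
    have := mul_le_mul_of_nonneg_right (hA N hN) (by positivity : 0 ≤ (N : ℝ) ^ (-β))
    have : 0 ≤ B * (1 - (2 : ℝ) ^ (-β))⁻¹ * (N : ℝ) ^ (-β) := by positivity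
    linarith
  · rcases le_total M N with hMN | hNM
    · rw [Finset.Ico_eq_empty_of_le hMN]
      simp only [Finset.sum_empty]
      positivity
    have hterm : ∀ h ∈ Finset.Ico N M,
        ‖l (h + 1) * ((((h + 1 : ℕ) : ℝ) ^ (-β) : ℝ) : ℂ) - l h * (((h : ℝ) ^ (-β) : ℝ) : ℂ)‖
          ≤ ‖l (h + 1) - l h‖ * (h : ℝ) ^ (-β)
            + A * ((h : ℝ) ^ (-β) - ((h + 1 : ℕ) : ℝ) ^ (-β)) := by
      intro h hh
      have h1 : 1 ≤ h := hN.trans (Finset.mem_Ico.1 hh).1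
      have e : l (h + 1) * ((((h + 1 : ℕ) : ℝ) ^ (-β) : ℝ) : ℂ)
          - l h * (((h : ℝ) ^ (-β) : ℝ) : ℂ)
          = (l (h + 1) - l h) * (((h : ℝ) ^ (-β) : ℝ) : ℂ)
            - l (h + 1) * (((h : ℝ) ^ (-β) - ((h + 1 : ℕ) : ℝ) ^ (-β) : ℝ) : ℂ) := by
        push_cast; ring
      rw [e]
      refine (norm_sub_le _ _).trans ?_
      rw [norm_mul, norm_mul, Complex.norm_real, Complex.norm_real,
        Real.norm_of_nonneg (by positivity), Real.norm_of_nonneg (sub_nonneg.2 (hanti h h1))]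
      gcongr
      · exact sub_nonneg.2 (hanti h h1)
      · exact hA _ (by omega)
    have htel : ∑ h ∈ Finset.Ico N M, ((h : ℝ) ^ (-β) - ((h + 1 : ℕ) : ℝ) ^ (-β))
        ≤ (N : ℝ) ^ (-β) := by
      have : ∀ M, N ≤ M → ∑ h ∈ Finset.Ico N M, ((h : ℝ) ^ (-β) - ((h + 1 : ℕ) : ℝ) ^ (-β))
          = (N : ℝ) ^ (-β) - (M : ℝ) ^ (-β) := by
        intro M hM
        induction M, hM using Nat.le_induction with
        | base => simp
        | succ M hM ih => rw [Finset.sum_Ico_succ_top hM, ih]; ring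
      rw [this M hNM]
      linarith [(by positivity : (0 : ℝ) ≤ (M : ℝ) ^ (-β))]
    have hdy : ∑ h ∈ Finset.Ico N M, ‖l (h + 1) - l h‖ * (h : ℝ) ^ (-β)
        ≤ B * (N : ℝ) ^ (-β) * (1 - (2 : ℝ) ^ (-β))⁻¹ := by
      have hMk : M ≤ 2 ^ M * N := (Nat.lt_two_pow_self).le.trans (Nat.le_mul_of_pos_right _ hN)
      refine (Finset.sum_le_sum_of_subset_of_nonneg (Finset.Ico_subset_Ico_right hMk)
        fun _ _ _ => by positivity).trans
        ((sum_Ico_dyadic_le (fun _ => norm_nonneg _) hβ hB hN M).trans ?_)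
      refine mul_le_mul_of_nonneg_left ?_ (by positivity)
      rw [← tsum_geometric_of_lt_one hq0 hq1]
      exact (summable_geometric_of_lt_one hq0 hq1).sum_le_tsum _ fun _ _ => by positivity
    refine (Finset.sum_le_sum hterm).trans ?_
    rw [Finset.sum_add_distrib, ← Finset.mul_sum]
    have := mul_le_mul_of_nonneg_left htel hA0
    linarith

theorem powerBV_rpow_neg {β : ℝ} (hβ : 0 < β) :
    PowerBV β (fun h => (((h : ℝ) ^ (-β) : ℝ) : ℂ)) := by
  simpa using PowerBV.of_dyadic (l := fun _ => 1) (A := 1) (B := 0) hβ (by simp) (by simp)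

theorem sum_Ico_abs_sub_le_variation {L : ℝ → ℝ} (hL : IsLocallyBV L) {N M : ℕ} (hN : 1 ≤ N)
    (hNM : N ≤ M) :
    ∑ h ∈ Finset.Ico N M, |L ((h + 1 : ℕ) : ℝ) - L h|
      ≤ (eVariationOn L (Ioc 0 (M : ℝ))).toReal - (eVariationOn L (Ioc 0 (N : ℝ))).toReal := by
  induction M, hNM using Nat.le_induction with
  | base => simp
  | succ M hM ih =>
    rw [Finset.sum_Ico_succ_top hM]
    have hM0 : (0 : ℝ) < M := by exact_mod_cast hN.trans hM
    have hlt : (M : ℝ) ≤ ((M + 1 : ℕ) : ℝ) := by push_cast; linarith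
    have h1 := eVariationOn.add_le_union L (s := Ioc 0 (M : ℝ))
      (t := Icc (M : ℝ) ((M + 1 : ℕ) : ℝ)) (fun x hx y hy => hx.2.trans hy.1)
    rw [Ioc_union_Icc_eq_Ioc hM0 hlt] at h1
    have h2 : edist (L ((M + 1 : ℕ) : ℝ)) (L M)
        ≤ eVariationOn L (Icc (M : ℝ) ((M + 1 : ℕ) : ℝ)) :=
      eVariationOn.edist_le L (right_mem_Icc.2 hlt) (left_mem_Icc.2 hlt)
    have h3 := ENNReal.toReal_mono (hL _) ((add_le_add_right h2 _).trans h1)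
    rw [ENNReal.toReal_add (hL _) (edist_ne_top _ _), edist_dist, ENNReal.toReal_ofReal dist_nonneg,
      Real.dist_eq] at h3
    linarith

theorem variation_sub_le_variationMeasure {L : ℝ → ℝ} (hL : IsLocallyBV L) {x y z : ℝ}
    (hxy : x < y) :
    (eVariationOn L (Ioc 0 z)).toReal - (eVariationOn L (Ioc 0 y)).toReal
      ≤ (variationMeasure L hL).real (Ioc x z) := by
  rw [variationMeasure, Measure.real, StieltjesFunction.measure_Ioc, Monotone.stieltjesFunction_eq,
    Monotone.stieltjesFunction_eq]
  refine le_trans ?_ ((le_max_left _ _).trans_eq ENNReal.toReal_ofReal'.symm)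
  exact sub_le_sub (hL.monotone_variation.le_rightLim le_rfl)
    (hL.monotone_variation.rightLim_le hxy)

instance (L : ℝ → ℝ) (hL : IsLocallyBV L) : IsLocallyFiniteMeasure (variationMeasure L hL) := by
  unfold variationMeasure; infer_instance

/-- For a bounded quasi-monotone function the variation over the dyadic blocks is bounded. -/
theorem IsQuasiMonotoneSV.exists_dyadic_variation_le {L : ℝ → ℝ} (hL : IsQuasiMonotoneSV L)
    {b : ℝ} (hb : Tendsto L atTop (𝓝 b)) :
    ∃ B : ℝ, ∀ N : ℕ, 1 ≤ N →
      ∑ h ∈ Finset.Ico N (2 * N), |L ((h + 1 : ℕ) : ℝ) - L h| ≤ B := by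
  obtain ⟨δ, hδ, hO⟩ := hL.quasi
  obtain ⟨C, hC⟩ := (hO.trans ((Asymptotics.isBigO_refl (fun x : ℝ => x ^ δ) atTop).mul
    (hb.isBigO_one ℝ))).bound
  have hint : ∀ x, IntegrableOn (fun u : ℝ => u ^ δ) (Ioc 0 x) (variationMeasure L hL.bv) :=
    fun x => ((Real.continuous_rpow_const hδ.le).continuousOn.integrableOn_compact
      isCompact_Icc).mono_set Ioc_subset_Icc_self
  have hev : ∀ᶠ N : ℕ in atTop,
      ∑ h ∈ Finset.Ico N (2 * N), |L ((h + 1 : ℕ) : ℝ) - L h| ≤ C * 4 ^ δ := by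
    have hcast : Tendsto (fun N : ℕ => 2 * (N : ℝ)) atTop atTop :=
      tendsto_natCast_atTop_atTop.const_mul_atTop (by norm_num)
    filter_upwards [hcast.eventually hC, eventually_ge_atTop 1] with N hCN hN
    have hN0 : (0 : ℝ) < N := by exact_mod_cast hN
    refine (sum_Ico_abs_sub_le_variation hL.bv hN (by omega)).trans ?_
    push_cast
    -- the block is enlarged to `(N/2, 2N]`, so that it contains the left end point
    have hvar := variation_sub_le_variationMeasure hL.bv (x := N / 2) (y := N) (z := 2 * N)
      (by linarith)
    refine hvar.trans ?_
    have hsub : Ioc ((N : ℝ) / 2) (2 * N) ⊆ Ioc 0 (2 * N) := Ioc_subset_Ioc_left (by positivity)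
    have hfin : (variationMeasure L hL.bv) (Ioc ((N : ℝ) / 2) (2 * N)) ≠ ⊤ :=
      (measure_Ioc_lt_top).ne
    have h1 : ((N : ℝ) / 2) ^ δ * (variationMeasure L hL.bv).real (Ioc ((N : ℝ) / 2) (2 * N))
        ≤ ∫ u in Ioc 0 (2 * (N : ℝ)), u ^ δ ∂(variationMeasure L hL.bv) := by
      refine le_trans ?_ (setIntegral_mono_set (hint _) ?_ (Eventually.of_forall hsub))
      · have := setIntegral_ge_of_const_le_real (μ := variationMeasure L hL.bv)
          (f := fun u : ℝ => u ^ δ) (c := ((N : ℝ) / 2) ^ δ) measurableSet_Ioc hfin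
          (fun u hu => Real.rpow_le_rpow (by positivity) hu.1.le hδ.le)
          ((hint _).mono_set hsub)
        exact this
      · filter_upwards [ae_restrict_mem measurableSet_Ioc] with u hu
        exact Real.rpow_nonneg hu.1.le _
    have h2 : ((N : ℝ) / 2) ^ δ * (variationMeasure L hL.bv).real (Ioc ((N : ℝ) / 2) (2 * N))
        ≤ ((N : ℝ) / 2) ^ δ * (C * 4 ^ δ) := by
      refine h1.trans ((le_abs_self _).trans (hCN.trans (le_of_eq ?_)))
      rw [mul_one, Real.norm_of_nonneg (by positivity),
        show 2 * (N : ℝ) = (N / 2) * 4 by ring, Real.mul_rpow (by positivity) (by norm_num)]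
      ring
    exact le_of_mul_le_mul_left h2 (by positivity)
  obtain ⟨N₀, hN₀⟩ := eventually_atTop.1 hev
  have hnn : ∀ N : ℕ, 0 ≤ ∑ h ∈ Finset.Ico N (2 * N), |L ((h + 1 : ℕ) : ℝ) - L h| :=
    fun N => Finset.sum_nonneg fun _ _ => abs_nonneg _
  refine ⟨C * 4 ^ δ + ∑ N ∈ Finset.range N₀,
    ∑ h ∈ Finset.Ico N (2 * N), |L ((h + 1 : ℕ) : ℝ) - L h|, fun N _ => ?_⟩
  rcases le_or_gt N₀ N with h | h
  · linarith [hN₀ N h, Finset.sum_nonneg fun N (_ : N ∈ Finset.range N₀) => hnn N]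
  · linarith [hN₀ N₀ le_rfl, hnn N₀, Finset.single_le_sum (fun N _ => hnn N) (Finset.mem_range.2 h)]

theorem IsQuasiMonotoneSV.powerBV {L : ℝ → ℝ} (hL : IsQuasiMonotoneSV L)
    {b : ℝ} (hb : Tendsto L atTop (𝓝 b)) {β : ℝ} (hβ : 0 < β) :
    PowerBV β (fun h => ((L h : ℝ) : ℂ) * (((h : ℝ) ^ (-β) : ℝ) : ℂ)) := by
  obtain ⟨B, hB⟩ := hL.exists_dyadic_variation_le hb
  obtain ⟨A, hA⟩ := (hb.comp tendsto_natCast_atTop_atTop).norm.bddAbove_range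
  refine PowerBV.of_dyadic (l := fun h : ℕ => ((L h : ℝ) : ℂ)) (A := A) (B := B) hβ ?_ ?_
  · intro N _
    rw [Complex.norm_real]
    exact hA ⟨N, rfl⟩
  · intro N hN
    refine le_trans (le_of_eq (Finset.sum_congr rfl fun h _ => ?_)) (hB N hN)
    rw [← Complex.ofReal_sub, Complex.norm_real, Real.norm_eq_abs]


/-! ### The singularity of `∑ h^{s-1} w^h` at `w = 1` -/

/-- The difference between `h^{s-1}` and `Γ(h+s)/h!`, which is `Γ(s)` times the coefficient of
`w^h` in `(1 - w)^{-s}`. At `h = 0` the power is `0`, for `s ≠ 1`, and the difference is `-Γ(s)`. -/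
def gautschiDefect (s : ℝ) (h : ℕ) : ℝ :=
  (h : ℝ) ^ (s - 1) - Real.Gamma (h + s) / (h.factorial : ℝ)

/-- Gautschi's inequality, from the logarithmic convexity of `Γ`. -/
theorem gautschiDefect_mem {s : ℝ} (hs0 : 0 < s) (hs1 : s < 1) {h : ℕ} (hh : 1 ≤ h) :
    0 ≤ gautschiDefect s h ∧
      gautschiDefect s h ≤ (h : ℝ) ^ (s - 1) - ((h + 1 : ℕ) : ℝ) ^ (s - 1) := by
  have h0 : (0 : ℝ) < h := by exact_mod_cast hh
  have hf : (0 : ℝ) < (h.factorial : ℝ) := by exact_mod_cast h.factorial_pos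
  have hG1 : Real.Gamma ((h : ℝ) + 1) = (h.factorial : ℝ) := Real.Gamma_nat_eq_factorial h
  have hG : 0 < Real.Gamma (h : ℝ) := Real.Gamma_pos_of_pos h0
  have hGs : 0 < Real.Gamma ((h : ℝ) + s) := Real.Gamma_pos_of_pos (by positivity)
  have hrec : Real.Gamma ((h : ℝ) + 1) = h * Real.Gamma h := Real.Gamma_add_one h0.ne'
  constructor
  · rw [gautschiDefect, sub_nonneg, div_le_iff₀ hf]
    have := Real.Gamma_mul_add_mul_le_rpow_Gamma_mul_rpow_Gamma (s := h) (t := (h : ℝ) + 1)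
      (a := 1 - s) (b := s) h0 (by positivity) (by linarith) hs0 (by ring)
    rw [show (1 - s) * (h : ℝ) + s * ((h : ℝ) + 1) = h + s by ring] at this
    refine this.trans (le_of_eq ?_)
    rw [← hG1, hrec, Real.mul_rpow h0.le hG.le, mul_left_comm, ← Real.rpow_add hG,
      sub_add_cancel, Real.rpow_one, Real.rpow_sub_one h0.ne']
    field_simp
  · rw [gautschiDefect]
    refine sub_le_sub_left ?_ _
    rw [le_div_iff₀ hf]
    have := Real.Gamma_mul_add_mul_le_rpow_Gamma_mul_rpow_Gamma (s := (h : ℝ) + s)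
      (t := (h : ℝ) + s + 1) (a := s) (b := 1 - s) (by positivity) (by positivity) hs0
      (by linarith) (by ring)
    rw [show s * ((h : ℝ) + s) + (1 - s) * ((h : ℝ) + s + 1) = h + 1 by ring,
      Real.Gamma_add_one (by positivity : (h : ℝ) + s ≠ 0),
      Real.mul_rpow (by positivity) hGs.le, mul_left_comm, ← Real.rpow_add hGs,
      add_sub_cancel, Real.rpow_one, hG1] at this
    have hp : (0 : ℝ) < (h : ℝ) + s := by positivity
    calc ((h + 1 : ℕ) : ℝ) ^ (s - 1) * (h.factorial : ℝ)
        ≤ ((h : ℝ) + s) ^ (s - 1) * (h.factorial : ℝ) := by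
          refine mul_le_mul_of_nonneg_right ?_ hf.le
          exact Real.rpow_le_rpow_of_nonpos hp (by push_cast; linarith) (by linarith)
      _ ≤ ((h : ℝ) + s) ^ (s - 1) * (((h : ℝ) + s) ^ (1 - s) * Real.Gamma (h + s)) :=
          mul_le_mul_of_nonneg_left this (by positivity)
      _ = Real.Gamma (h + s) := by
          rw [← mul_assoc, ← Real.rpow_add hp]; simp

theorem sum_range_abs_gautschiDefect_le {s : ℝ} (hs0 : 0 < s) (hs1 : s < 1) (n : ℕ) :
    ∑ h ∈ Finset.range n, |gautschiDefect s h| ≤ Real.Gamma s + 1 := by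
  have hG : 0 < Real.Gamma s := Real.Gamma_pos_of_pos hs0
  have key : ∀ n : ℕ, ∑ h ∈ Finset.range (n + 1), |gautschiDefect s h|
      ≤ Real.Gamma s + 1 - ((n + 1 : ℕ) : ℝ) ^ (s - 1) := by
    intro n
    induction n with
    | zero =>
      simp [gautschiDefect, Real.zero_rpow (by linarith : s - 1 ≠ 0), abs_of_pos hG]
    | succ n ih =>
      rw [Finset.sum_range_succ]
      have h1 := gautschiDefect_mem hs0 hs1 (h := n + 1) (by omega)
      rw [abs_of_nonneg h1.1]
      linarith [h1.2]
  rcases n with _ | n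
  · simp only [Finset.range_zero, Finset.sum_empty]; linarith
  · linarith [key n, (by positivity : (0 : ℝ) ≤ ((n + 1 : ℕ) : ℝ) ^ (s - 1))]

theorem choose_eq_Gamma_div {s : ℝ} (hs : 0 < s) (n : ℕ) :
    Ring.choose ((s : ℂ) + n - 1) n
      = ((Real.Gamma (n + s) / (n.factorial : ℝ) / Real.Gamma s : ℝ) : ℂ) := by
  have hasc : ∀ n : ℕ, (ascPochhammer ℕ n).smeval (s : ℂ)
      = ((Real.Gamma (n + s) / Real.Gamma s : ℝ) : ℂ) := by
    intro n
    induction n with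
    | zero =>
      have : Real.Gamma s ≠ 0 := (Real.Gamma_pos_of_pos hs).ne'
      simp [this, Polynomial.smeval_one]
    | succ n ih =>
      rw [ascPochhammer_succ_right, Polynomial.smeval_mul, ih, Polynomial.smeval_add,
        Polynomial.smeval_X, Polynomial.smeval_natCast]
      have : Real.Gamma (((n + 1 : ℕ) : ℝ) + s) = (n + s) * Real.Gamma (n + s) := by
        rw [← Real.Gamma_add_one (by positivity)]
        push_cast; ring_nf
      rw [this]
      push_cast
      simp
      ring
  have h1 := Ring.factorial_nsmul_multichoose_eq_ascPochhammer (s : ℂ) n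
  rw [hasc n, nsmul_eq_mul] at h1
  have hf : (n.factorial : ℂ) ≠ 0 := by exact_mod_cast n.factorial_ne_zero
  rw [Ring.choose, show (s : ℂ) + n - 1 - n + 1 = s by ring, eq_comm]
  apply mul_left_cancel₀ hf
  rw [h1]
  push_cast
  field_simp

/-- The binomial series of `(1 - w)^{-s}` has the expected sum also on the unit circle, wherever it
converges. -/
theorem eq_one_sub_cpow_of_tendsto {s : ℂ} {w l : ℂ} (hw : ‖w‖ = 1) (hw1 : w ≠ 1)
    (h : Tendsto (fun n => ∑ i ∈ Finset.range n, Ring.choose (s + i - 1) i * w ^ i)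
      atTop (𝓝 l)) :
    l = (1 - w) ^ (-s) := by
  have habel := Complex.tendsto_tsum_powerSeries_nhdsWithin_lt h
  rw [tendsto_map'_iff] at habel
  have hslit : 1 - w ∈ Complex.slitPlane := by
    left
    have h1 : w.re ≤ 1 := hw ▸ Complex.re_le_norm w
    have h2 : w.re ≠ 1 := by
      intro h2
      apply hw1
      have : w.re = ‖w‖ := by rw [h2, hw]
      have h3 := Complex.re_eq_norm.1 this
      exact Complex.ext h2 (by simpa using (Complex.le_def.1 h3).2.symm)
    simp only [Complex.sub_re, Complex.one_re, sub_pos]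
    exact lt_of_le_of_ne h1 h2
  have hcont : Tendsto (fun r : ℝ => (1 - w * (r : ℂ)) ^ (-s)) (𝓝[<] 1) (𝓝 ((1 - w) ^ (-s))) := by
    have : ContinuousAt (fun r : ℝ => (1 - w * (r : ℂ)) ^ (-s)) 1 :=
      ContinuousAt.cpow (by fun_prop) continuousAt_const (by simpa using hslit)
    simpa [ContinuousAt] using this.tendsto.mono_left nhdsWithin_le_nhds
  refine tendsto_nhds_unique habel (hcont.congr' ?_)
  filter_upwards [Ioo_mem_nhdsLT (zero_lt_one' ℝ)] with r hr
  have hr1 : ‖w * (r : ℂ)‖ < 1 := by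
    rw [norm_mul, hw, one_mul, Complex.norm_real, Real.norm_of_nonneg hr.1.le]
    exact hr.2
  have hs := (Complex.one_div_one_sub_cpow_hasFPowerSeriesOnBall_zero s).hasSum
    (y := w * (r : ℂ)) (by
      rw [← ENNReal.ofReal_one, Metric.eball_ofReal, mem_ball_zero_iff]
      exact hr1)
  simp only [FormalMultilinearSeries.ofScalars_apply_eq, zero_add, smul_eq_mul] at hs
  rw [Function.comp_apply, Complex.cpow_neg, ← one_div, ← hs.tsum_eq]
  exact tsum_congr fun n => by rw [mul_pow, mul_assoc]

/-- Up to a bounded function, `∑ h^{s-1} w^h` is `Γ(s) (1 - w)^{-s}` on the unit circle. -/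
theorem norm_oscSum_rpow_sub_le {s : ℝ} (hs0 : 0 < s) (hs1 : s < 1) {w : ℂ} (hw : ‖w‖ = 1)
    (hw1 : w ≠ 1) :
    ‖oscSum (fun h => (((h : ℝ) ^ (s - 1) : ℝ) : ℂ)) w
      - (Real.Gamma s : ℂ) * (1 - w) ^ (-(s : ℂ))‖ ≤ Real.Gamma s + 1 := by
  have hG : 0 < Real.Gamma s := Real.Gamma_pos_of_pos hs0
  have hGc : (Real.Gamma s : ℂ) ≠ 0 := by exact_mod_cast hG.ne'
  have hpow := (powerBV_rpow_neg (β := 1 - s) (by linarith)).tendsto_oscSum (by linarith) hw hw1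
  simp only [neg_sub] at hpow
  set g := oscSum (fun h => (((h : ℝ) ^ (s - 1) : ℝ) : ℂ)) w with hg
  have hsum : Summable fun h => |gautschiDefect s h| :=
    summable_of_sum_range_le (fun _ => abs_nonneg _) (sum_range_abs_gautschiDefect_le hs0 hs1)
  have hnorm : ∀ h : ℕ, ‖(gautschiDefect s h : ℂ) * w ^ h‖ = |gautschiDefect s h| := by
    intro h; simp [hw]
  have hsumw : Summable fun h : ℕ => (gautschiDefect s h : ℂ) * w ^ h :=
    Summable.of_norm (by simpa only [hnorm] using hsum)
  have hbound : ‖∑' h : ℕ, (gautschiDefect s h : ℂ) * w ^ h‖ ≤ Real.Gamma s + 1 := by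
    refine (norm_tsum_le_tsum_norm (by simpa only [hnorm] using hsum)).trans ?_
    simp only [hnorm]
    exact hsum.tsum_le_of_sum_range_le (sum_range_abs_gautschiDefect_le hs0 hs1)
  have hlim : Tendsto (fun n => ∑ i ∈ Finset.range n, Ring.choose ((s : ℂ) + i - 1) i * w ^ i)
      atTop (𝓝 ((g - ∑' h : ℕ, (gautschiDefect s h : ℂ) * w ^ h) / (Real.Gamma s : ℂ))) := by
    refine ((hpow.sub hsumw.hasSum.tendsto_sum_nat).div_const _).congr fun M => ?_
    have h0 : ∑ h ∈ Finset.Ico 1 M, (((h : ℝ) ^ (s - 1) : ℝ) : ℂ) * w ^ h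
        = ∑ h ∈ Finset.range M, (((h : ℝ) ^ (s - 1) : ℝ) : ℂ) * w ^ h := by
      rcases M with _ | M
      · simp
      · rw [Finset.range_eq_Ico, Finset.sum_eq_sum_Ico_succ_bot (by omega : 0 < M + 1)]
        simp [Real.zero_rpow (by linarith : s - 1 ≠ 0)]
    rw [h0, ← Finset.sum_sub_distrib, Finset.sum_div]
    refine Finset.sum_congr rfl fun i _ => ?_
    rw [choose_eq_Gamma_div hs0, gautschiDefect]
    push_cast
    field_simp
    ring
  have heq := eq_one_sub_cpow_of_tendsto hw hw1 hlim
  rw [← heq, mul_div_cancel₀ _ hGc, sub_sub_cancel]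
  exact hbound

theorem ofReal_mul_cpow {r : ℝ} (hr : 0 < r) (z c : ℂ) :
    ((r : ℂ) * z) ^ c = (r : ℂ) ^ c * z ^ c := by
  have hrc : (r : ℂ) ≠ 0 := by exact_mod_cast hr.ne'
  by_cases hz : z = 0
  · by_cases hc : c = 0
    · simp [hc]
    · simp [hz, Complex.zero_cpow hc]
  · rw [Complex.cpow_def_of_ne_zero (mul_ne_zero hrc hz), Complex.cpow_def_of_ne_zero hrc,
      Complex.cpow_def_of_ne_zero hz, ← Complex.exp_add, Complex.log_ofReal_mul hr hz,
      Complex.ofReal_log hr.le, add_mul]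

/-- On the two sides of `w = 1` the function `(1 - w)^{-s}` is asymptotic to
`(∓ix)^{-s} = x^{-s} e^{±iπs/2}`; the sign is `σ`. -/
theorem tendsto_rpow_mul_one_sub_exp_cpow (s : ℝ) {σ : ℝ} (hσ : σ = 1 ∨ σ = -1) :
    Tendsto (fun x : ℝ => ((x ^ s : ℝ) : ℂ) * (1 - Complex.exp ((σ * x : ℝ) * Complex.I)) ^
      (-(s : ℂ))) (𝓝[>] 0) (𝓝 (Complex.exp ((σ * (Real.pi * s / 2) : ℝ) * Complex.I))) := by
  have hder : HasDerivAt (fun x : ℝ => 1 - Complex.exp ((σ * x : ℝ) * Complex.I))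
      (-(σ * Complex.I)) 0 := by
    have h1 : HasDerivAt (fun x : ℝ => ((σ * x : ℝ) : ℂ) * Complex.I) (σ * Complex.I) 0 := by
      have := (((hasDerivAt_id (0 : ℝ)).const_mul σ).ofReal_comp).mul_const Complex.I
      simpa using this
    simpa using (h1.cexp).const_sub 1
  have hslope : Tendsto (fun x : ℝ => (1 - Complex.exp ((σ * x : ℝ) * Complex.I)) / (x : ℂ))
      (𝓝[>] 0) (𝓝 (-(σ * Complex.I))) := by
    have := (hasDerivAt_iff_tendsto_slope_zero.1 hder).mono_left
      (nhdsWithin_mono 0 (fun x (hx : 0 < x) => hx.ne'))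
    refine this.congr fun x => ?_
    simp [div_eq_inv_mul]
  have hslit : -((σ : ℂ) * Complex.I) ∈ Complex.slitPlane := by
    right
    rcases hσ with h | h <;> simp [h]
  have hval : (-((σ : ℂ) * Complex.I)) ^ (-(s : ℂ))
      = Complex.exp ((σ * (Real.pi * s / 2) : ℝ) * Complex.I) := by
    rcases hσ with h | h
    · rw [h, Complex.cpow_def_of_ne_zero (by simp)]
      simp only [Complex.ofReal_one, one_mul, Complex.log_neg_I]
      push_cast
      congr 1; ring
    · rw [h, Complex.cpow_def_of_ne_zero (by simp)]
      simp only [Complex.ofReal_neg, Complex.ofReal_one, neg_mul, one_mul, neg_neg,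
        Complex.log_I]
      push_cast
      congr 1; ring
  have hc : Tendsto (fun x : ℝ => ((1 - Complex.exp ((σ * x : ℝ) * Complex.I)) / (x : ℂ)) ^
      (-(s : ℂ))) (𝓝[>] 0) (𝓝 (Complex.exp ((σ * (Real.pi * s / 2) : ℝ) * Complex.I))) := by
    rw [← hval]
    exact hslope.cpow tendsto_const_nhds hslit
  refine hc.congr' ?_
  filter_upwards [self_mem_nhdsWithin] with x (hx : 0 < x)
  have hxs : ((x ^ s : ℝ) : ℂ) = ((x : ℂ)⁻¹) ^ (-(s : ℂ)) := by
    rw [← Complex.ofReal_inv, ← Complex.ofReal_neg, ← Complex.ofReal_cpow (inv_nonneg.2 hx.le),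
      Real.inv_rpow hx.le, Real.rpow_neg hx.le, inv_inv]
  rw [hxs, div_eq_mul_inv, mul_comm _ ((x : ℂ)⁻¹), ← Complex.ofReal_inv,
    ofReal_mul_cpow (inv_pos.2 hx)]

theorem tendsto_rpow_zero {s : ℝ} (hs : 0 < s) : Tendsto (fun x : ℝ => x ^ s) (𝓝[>] 0) (𝓝 0) := by
  have h := (Real.continuousAt_rpow_const 0 s (Or.inr hs.le)).tendsto
  rw [Real.zero_rpow hs.ne'] at h
  exact h.mono_left nhdsWithin_le_nhds

theorem exp_mul_I_ne_one {x : ℝ} (h0 : x ≠ 0) (h1 : -(2 * Real.pi) < x) (h2 : x < 2 * Real.pi) :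
    Complex.exp ((x : ℂ) * Complex.I) ≠ 1 := by
  intro h
  have hc : Real.cos x = 1 := by
    have := congrArg Complex.re h
    rwa [Complex.exp_ofReal_mul_I_re, Complex.one_re] at this
  exact h0 ((Real.cos_eq_one_iff_of_lt_of_lt h1 h2).1 hc)

/-- `x^s ∑ h^{s-1} e^{±ihx} → Γ(s) e^{±iπs/2}` as `x → 0+`. -/
theorem tendsto_rpow_mul_oscSum_rpow {s : ℝ} (hs0 : 0 < s) (hs1 : s < 1) {σ : ℝ}
    (hσ : σ = 1 ∨ σ = -1) :
    Tendsto (fun x : ℝ => ((x ^ s : ℝ) : ℂ) *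
      oscSum (fun h => (((h : ℝ) ^ (s - 1) : ℝ) : ℂ)) (Complex.exp ((σ * x : ℝ) * Complex.I)))
      (𝓝[>] 0)
      (𝓝 ((Real.Gamma s : ℂ) * Complex.exp ((σ * (Real.pi * s / 2) : ℝ) * Complex.I))) := by
  have h1 := (tendsto_rpow_mul_one_sub_exp_cpow s hσ).const_mul (Real.Gamma s : ℂ)
  have hx0 : Tendsto (fun x : ℝ => x ^ s * (Real.Gamma s + 1)) (𝓝[>] 0) (𝓝 0) := by
    simpa using (tendsto_rpow_zero hs0).mul_const (Real.Gamma s + 1)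
  have h2 : Tendsto (fun x : ℝ => ((x ^ s : ℝ) : ℂ) *
      (oscSum (fun h => (((h : ℝ) ^ (s - 1) : ℝ) : ℂ)) (Complex.exp ((σ * x : ℝ) * Complex.I))
        - (Real.Gamma s : ℂ) * (1 - Complex.exp ((σ * x : ℝ) * Complex.I)) ^ (-(s : ℂ))))
      (𝓝[>] 0) (𝓝 0) := by
    refine squeeze_zero_norm' ?_ hx0
    filter_upwards [Ioo_mem_nhdsGT (zero_lt_one' ℝ)] with x hx
    rw [norm_mul, Complex.norm_real, Real.norm_of_nonneg (Real.rpow_nonneg hx.1.le _)]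
    refine mul_le_mul_of_nonneg_left ?_ (Real.rpow_nonneg hx.1.le _)
    refine norm_oscSum_rpow_sub_le hs0 hs1 (Complex.norm_exp_ofReal_mul_I _) ?_
    have := Real.pi_gt_three
    refine exp_mul_I_ne_one ?_ ?_ ?_ <;> rcases hσ with h | h <;> rw [h] <;>
      linarith [hx.1, hx.2]
  have h3 := h2.add h1
  rw [zero_add] at h3
  refine h3.congr fun x => by ring


/-! ### Partial sums of the Fourier series of the autocovariances -/

/-- The partial sum `γ(0) + 2 ∑_{1 ≤ h < N} γ(h) cos(h x)`, that is, `∑_{|h| < N} γ(h) e^{ihx}` for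
even `γ`. -/
def cosPartialSum (γ : ℤ → ℝ) (N : ℕ) (x : ℝ) : ℝ :=
  γ 0 + 2 * ∑ h ∈ Finset.Ico 1 N, γ h * Real.cos (h * x)

theorem continuous_cosPartialSum (γ : ℤ → ℝ) (N : ℕ) : Continuous (cosPartialSum γ N) := by
  unfold cosPartialSum; fun_prop

theorem sum_sum_cos_eq_sum_cosPartialSum {γ : ℤ → ℝ} (hγ : ∀ h, γ (-h) = γ h) (x : ℝ) (n : ℕ) :
    ∑ j ∈ Finset.range n, ∑ k ∈ Finset.range n,
      γ ((j : ℤ) - k) * Real.cos (((j : ℤ) - k : ℤ) * x)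
      = ∑ N ∈ Finset.range n, cosPartialSum γ (N + 1) x := by
  induction n with
  | zero => simp
  | succ n ih =>
    have hcol : ∑ k ∈ Finset.range n, γ ((n : ℤ) - k) * Real.cos (((n : ℤ) - k : ℤ) * x)
        = ∑ h ∈ Finset.Ico 1 (n + 1), γ h * Real.cos (h * x) := by
      rw [Finset.range_eq_Ico, Finset.sum_Ico_eq_sum_range, ← Finset.sum_range_reflect,
        Finset.sum_Ico_eq_sum_range]
      refine Finset.sum_congr (by simp) fun k hk => ?_
      have hk' : k < n := by simpa using hk
      have : (n : ℤ) - ((0 + (n - 0 - 1 - k) : ℕ) : ℤ) = ((1 + k : ℕ) : ℤ) := by omega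
      rw [this]
      simp
    have hrow : ∑ j ∈ Finset.range n, γ ((j : ℤ) - n) * Real.cos (((j : ℤ) - n : ℤ) * x)
        = ∑ h ∈ Finset.Ico 1 (n + 1), γ h * Real.cos (h * x) := by
      rw [← hcol]
      refine Finset.sum_congr rfl fun j _ => ?_
      rw [← hγ, ← Real.cos_neg, neg_sub, ← neg_mul, ← Int.cast_neg, neg_sub]
    simp only [Finset.sum_range_succ, Finset.sum_add_distrib]
    rw [← ih, hcol, hrow, cosPartialSum]
    simp
    ring

variable {Ω : Type*} [MeasurableSpace Ω] {P : Measure Ω} {X : ℤ → Ω → ℝ}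

theorem IsSecondOrderStationary.acvf_neg (hX : IsSecondOrderStationary P X) (h : ℤ) :
    acvf P X (-h) = acvf P X h := by
  have := hX.shift (-h) h
  rw [neg_add_cancel] at this
  rw [acvf, acvf, ← this]
  simp only [mul_comm]

theorem IsSecondOrderStationary.integral_mul (hX : IsSecondOrderStationary P X) (j k : ℤ) :
    ∫ ω, X j ω * X k ω ∂P = acvf P X (j - k) := by
  rw [acvf, ← hX.shift k (j - k), add_sub_cancel]

/-- The left-hand side is the second moment of `∑_{j < n} e^{ijx} X_j`. -/
theorem IsSecondOrderStationary.sum_cosPartialSum_nonneg (hX : IsSecondOrderStationary P X)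
    (x : ℝ) (n : ℕ) : 0 ≤ ∑ N ∈ Finset.range n, cosPartialSum (acvf P X) (N + 1) x := by
  rw [← sum_sum_cos_eq_sum_cosPartialSum hX.acvf_neg]
  have hint : ∀ j k : ℤ, Integrable (fun ω => X j ω * X k ω) P := fun j k =>
    (hX.memLp j).integrable_mul (hX.memLp k)
  have hsq : ∀ c : ℕ → ℝ, 0 ≤ ∑ j ∈ Finset.range n, ∑ k ∈ Finset.range n,
      c j * c k * acvf P X ((j : ℤ) - k) := by
    intro c
    have : ∫ ω, (∑ j ∈ Finset.range n, c j * X j ω) ^ 2 ∂P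
        = ∑ j ∈ Finset.range n, ∑ k ∈ Finset.range n, c j * c k * acvf P X ((j : ℤ) - k) := by
      simp only [sq, Finset.sum_mul_sum]
      rw [integral_finsetSum]
      · refine Finset.sum_congr rfl fun j _ => ?_
        rw [integral_finsetSum]
        · refine Finset.sum_congr rfl fun k _ => ?_
          rw [← hX.integral_mul, ← integral_const_mul]
          exact integral_congr_ae (Eventually.of_forall fun ω => by ring)
        · intro k _
          exact ((hint j k).const_mul (c j * c k)).congr
            (Eventually.of_forall fun ω => by ring)
      · intro j _
        refine integrable_finsetSum _ fun k _ => ?_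
        exact ((hint j k).const_mul (c j * c k)).congr
          (Eventually.of_forall fun ω => by ring)
    rw [← this]
    exact integral_nonneg fun ω => sq_nonneg _
  refine (add_nonneg (hsq fun j => Real.cos (j * x)) (hsq fun j => Real.sin (j * x))).trans_eq ?_
  rw [← Finset.sum_add_distrib]
  refine Finset.sum_congr rfl fun j _ => ?_
  rw [← Finset.sum_add_distrib]
  refine Finset.sum_congr rfl fun k _ => ?_
  push_cast
  rw [sub_mul, Real.cos_sub]
  ring

/-- Where the Fourier series of the autocovariances converges, its sum is nonnegative, being the
limit of the nonnegative Fejér means. -/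
theorem IsSecondOrderStationary.nonneg_of_tendsto (hX : IsSecondOrderStationary P X) {x l : ℝ}
    (h : Tendsto (fun N => cosPartialSum (acvf P X) N x) atTop (𝓝 l)) : 0 ≤ l := by
  have h1 := ((tendsto_add_atTop_iff_nat 1).2 h).cesaro
  exact ge_of_tendsto' h1 fun n =>
    mul_nonneg (by positivity) (hX.sum_cosPartialSum_nonneg x n)

theorem integral_exp_I_mul_int (n : ℤ) :
    ∫ x in Ioo (-Real.pi) Real.pi, Complex.exp (Complex.I * (n : ℂ) * (x : ℂ))
      = if n = 0 then 2 * (Real.pi : ℂ) else 0 := by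
  rw [← integral_Ioc_eq_integral_Ioo,
    ← intervalIntegral.integral_of_le (by linarith [Real.pi_pos])]
  split_ifs with h
  · simp [h]
    ring
  · have hc : Complex.I * (n : ℂ) ≠ 0 := mul_ne_zero Complex.I_ne_zero (by exact_mod_cast h)
    rw [integral_exp_mul_complex hc]
    have : Complex.I * (n : ℂ) * (Real.pi : ℂ)
        = Complex.I * (n : ℂ) * ((-Real.pi : ℝ) : ℂ) + n * (2 * Real.pi * Complex.I) := by
      push_cast; ring
    rw [this, Complex.exp_add, Complex.exp_int_mul_two_pi_mul_I, mul_one, sub_self, zero_div]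

theorem integral_exp_mul_cosPartialSum {γ : ℤ → ℝ} (hγ : ∀ h, γ (-h) = γ h) (h : ℤ) {N : ℕ}
    (hN : h.natAbs < N) :
    ∫ x in Ioo (-Real.pi) Real.pi,
      Complex.exp (Complex.I * (h : ℂ) * (x : ℂ)) * (cosPartialSum γ N x : ℂ)
      = 2 * Real.pi * γ h := by
  have hint : ∀ n : ℤ, IntegrableOn (fun x : ℝ => Complex.exp (Complex.I * (n : ℂ) * (x : ℂ)))
      (Ioo (-Real.pi) Real.pi) := fun n =>
    (Continuous.integrableOn_Icc (by fun_prop)).mono_set Ioo_subset_Icc_self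
  have hpt : ∀ x : ℝ, Complex.exp (Complex.I * (h : ℂ) * (x : ℂ)) * (cosPartialSum γ N x : ℂ)
      = γ 0 * Complex.exp (Complex.I * (h : ℂ) * (x : ℂ)) + ∑ j ∈ Finset.Ico 1 N, (γ j : ℂ) *
        (Complex.exp (Complex.I * ((h + j : ℤ) : ℂ) * (x : ℂ))
          + Complex.exp (Complex.I * ((h - j : ℤ) : ℂ) * (x : ℂ))) := by
    intro x
    rw [cosPartialSum]
    push_cast
    rw [mul_add, mul_comm _ (γ 0 : ℂ), ← mul_assoc, Finset.mul_sum]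
    congr 1
    refine Finset.sum_congr rfl fun j _ => ?_
    have e1 : Complex.exp (Complex.I * ((h : ℂ) + j) * x)
        = Complex.exp (Complex.I * h * x) * Complex.exp (j * x * Complex.I) := by
      rw [← Complex.exp_add]; ring_nf
    have e2 : Complex.exp (Complex.I * ((h : ℂ) - j) * x)
        = Complex.exp (Complex.I * h * x) * Complex.exp (-(j * x) * Complex.I) := by
      rw [← Complex.exp_add]; ring_nf
    rw [e1, e2, Complex.cos]
    ring
  have hint2 : ∀ j : ℕ, IntegrableOn (fun x : ℝ => (γ j : ℂ) *
        (Complex.exp (Complex.I * ((h + j : ℤ) : ℂ) * (x : ℂ))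
          + Complex.exp (Complex.I * ((h - j : ℤ) : ℂ) * (x : ℂ)))) (Ioo (-Real.pi) Real.pi) :=
    fun j => ((hint _).add (hint _)).const_mul _
  simp only [hpt]
  rw [integral_add ((hint h).const_mul _) (integrable_finsetSum _ fun j _ => hint2 j),
    integral_finsetSum _ fun j _ => hint2 j, integral_const_mul, integral_exp_I_mul_int]
  have hterm : ∀ j ∈ Finset.Ico 1 N, ∫ x in Ioo (-Real.pi) Real.pi, (γ j : ℂ) *
        (Complex.exp (Complex.I * ((h + j : ℤ) : ℂ) * (x : ℂ))
          + Complex.exp (Complex.I * ((h - j : ℤ) : ℂ) * (x : ℂ)))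
      = if h.natAbs = j then 2 * Real.pi * (γ h : ℂ) else 0 := by
    intro j hj
    have hj1 : 1 ≤ j := (Finset.mem_Ico.1 hj).1
    rw [integral_const_mul, integral_add (hint _) (hint _), integral_exp_I_mul_int,
      integral_exp_I_mul_int]
    split_ifs with h1 h2 h3 h4 h5 h6 <;> first | omega | skip
    · rw [show h = -(j : ℤ) by omega, hγ]; ring
    · rw [show h = (j : ℤ) by omega]; ring
    · ring
  rw [Finset.sum_congr rfl hterm, Finset.sum_ite_eq]
  rcases eq_or_ne h 0 with rfl | h0
  · simp; ring
  · rw [if_neg h0, if_pos (Finset.mem_Ico.2 ⟨by omega, hN⟩)]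
    ring

/-- Dominated convergence of the Fourier series gives the Fourier coefficients of its sum. -/
theorem isSpectralDensity_of_tendsto_cosPartialSum {γ : ℤ → ℝ} (hγ : ∀ h, γ (-h) = γ h)
    {f g : ℝ → ℝ} (hf : ∀ x ∈ Ioo (-Real.pi) Real.pi, 0 ≤ f x)
    (hg : IntegrableOn g (Ioo (-Real.pi) Real.pi))
    (hbound : ∀ N, ∀ᵐ x ∂volume.restrict (Ioo (-Real.pi) Real.pi), |cosPartialSum γ N x| ≤ g x)
    (hlim : ∀ᵐ x ∂volume.restrict (Ioo (-Real.pi) Real.pi),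
      Tendsto (fun N => cosPartialSum γ N x) atTop (𝓝 (2 * Real.pi * f x))) :
    IsSpectralDensity γ f := by
  have hpi := Real.pi_pos
  have hmeas : AEStronglyMeasurable f (volume.restrict (Ioo (-Real.pi) Real.pi)) := by
    refine aestronglyMeasurable_of_tendsto_ae atTop
      (f := fun N x => (2 * Real.pi)⁻¹ * cosPartialSum γ N x)
      (fun N => ((continuous_cosPartialSum γ N).const_mul _).aestronglyMeasurable) ?_
    filter_upwards [hlim] with x hx
    have := hx.const_mul (2 * Real.pi)⁻¹
    rwa [inv_mul_cancel_left₀ (by positivity)] at this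
  refine ⟨hf, ?_, fun h => ?_⟩
  · refine (hg.const_mul (2 * Real.pi)⁻¹).mono' hmeas ?_
    filter_upwards [hlim, ae_all_iff.2 hbound] with x hx hb
    have := le_of_tendsto' hx.abs hb
    rw [abs_mul, abs_of_pos (by positivity : 0 < 2 * Real.pi)] at this
    rw [Real.norm_eq_abs, inv_mul_eq_div, le_div_iff₀ (by positivity), mul_comm]
    exact this
  · have hdom := tendsto_integral_of_dominated_convergence
      (μ := volume.restrict (Ioo (-Real.pi) Real.pi))
      (F := fun N x => Complex.exp (Complex.I * (h : ℂ) * (x : ℂ)) * (cosPartialSum γ N x : ℂ))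
      (f := fun x => Complex.exp (Complex.I * (h : ℂ) * (x : ℂ)) * ((2 * Real.pi * f x : ℝ) : ℂ))
      g (fun N => by
        have := continuous_cosPartialSum γ N
        exact Continuous.aestronglyMeasurable (by fun_prop)) hg
      (fun N => by
        filter_upwards [hbound N] with x hx
        rw [norm_mul, show Complex.I * (h : ℂ) * (x : ℂ) = ((h * x : ℝ) : ℂ) * Complex.I by
          push_cast; ring, Complex.norm_exp_ofReal_mul_I, one_mul, Complex.norm_real]
        exact hx)
      (by
        filter_upwards [hlim] with x hx
        exact ((Complex.continuous_ofReal.tendsto _).comp hx).const_mul _)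
    have hconst := tendsto_nhds_unique hdom (tendsto_const_nhds.congr' (by
      filter_upwards [eventually_gt_atTop h.natAbs] with N hN
      exact (integral_exp_mul_cosPartialSum hγ h hN).symm))
    have hre : ∀ x : ℝ, Complex.exp (Complex.I * (h : ℂ) * (x : ℂ)) * ((2 * Real.pi * f x : ℝ) : ℂ)
        = (2 * Real.pi : ℂ) * (Complex.exp (Complex.I * (h : ℂ) * (x : ℂ)) * (f x : ℂ)) := by
      intro x; push_cast; ring
    simp only [hre] at hconst
    rw [integral_const_mul] at hconst
    have h2pi : (2 * Real.pi : ℂ) ≠ 0 := by exact_mod_cast (by positivity : 2 * Real.pi ≠ 0)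
    exact (mul_left_cancel₀ h2pi hconst).symm

/-! ### The chordal distance to `1` on the unit circle -/

theorem mul_abs_le_norm_one_sub_exp {x : ℝ} (hx : |x| ≤ Real.pi) :
    2 / Real.pi * |x| ≤ ‖1 - Complex.exp ((x : ℂ) * Complex.I)‖ := by
  rw [norm_sub_rev, mul_comm (x : ℂ), Complex.norm_exp_I_mul_ofReal_sub_one, norm_mul,
    Real.norm_eq_abs, Real.norm_eq_abs, abs_two]
  have := Real.mul_abs_le_abs_sin (x := x / 2) (by rw [abs_div, abs_two]; linarith)
  rw [abs_div, abs_two] at this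
  linarith

theorem intervalIntegrable_norm_one_sub_exp_rpow {p : ℝ} (hp : -1 < p) (hp0 : p ≤ 0) (a b : ℝ) :
    IntervalIntegrable (fun x : ℝ => ‖1 - Complex.exp ((x : ℂ) * Complex.I)‖ ^ p) volume a b := by
  have hper : Function.Periodic (fun x : ℝ => ‖1 - Complex.exp ((x : ℂ) * Complex.I)‖ ^ p)
      (2 * Real.pi) := by
    intro x
    simp only
    push_cast
    rw [add_mul, Complex.exp_periodic]
  refine hper.intervalIntegrable (t := -Real.pi) (by positivity) ?_ a b
  rw [show -Real.pi + 2 * Real.pi = Real.pi by ring]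
  have hpos : IntervalIntegrable (fun x : ℝ => |x| ^ p) volume 0 Real.pi := by
    refine (intervalIntegral.intervalIntegrable_rpow' hp (a := 0) (b := Real.pi)).congr_ae ?_
    rw [uIoc_of_le Real.pi_pos.le]
    filter_upwards [ae_restrict_mem measurableSet_Ioc] with x hx
    rw [abs_of_pos hx.1]
  have hneg : IntervalIntegrable (fun x : ℝ => |x| ^ p) volume (-Real.pi) 0 := by
    rw [IntervalIntegrable.iff_comp_neg]
    simpa using hpos.symm
  refine ((hneg.trans hpos).const_mul ((2 / Real.pi) ^ p)).mono_fun
    (by fun_prop : Measurable _).aestronglyMeasurable ?_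
  rw [uIoc_of_le (by linarith [Real.pi_pos])]
  filter_upwards [ae_restrict_mem measurableSet_Ioc,
    ae_restrict_of_ae (Measure.ae_ne volume (0 : ℝ))] with x hx hx0
  have h1 := mul_abs_le_norm_one_sub_exp (abs_le.2 ⟨hx.1.le, hx.2⟩)
  have hpi := Real.pi_pos
  have hx0' : 0 < |x| := abs_pos.2 hx0
  rw [Real.norm_of_nonneg (by positivity), Real.norm_of_nonneg (by positivity),
    ← Real.mul_rpow (by positivity) (abs_nonneg _)]
  exact Real.rpow_le_rpow_of_nonpos (by positivity) h1 hp0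


/-! ### The spectral density and its behaviour at `λ₀` -/

theorem cosPartialSum_eq {γ : ℤ → ℝ} {a : ℕ → ℂ} {lam₀ : ℝ}
    (ha : ∀ h : ℕ, 1 ≤ h → γ h = (a h * Complex.exp ((lam₀ * h : ℝ) * Complex.I)).re)
    (N : ℕ) (x : ℝ) :
    cosPartialSum γ N x = γ 0
      + (∑ h ∈ Finset.Ico 1 N, a h * Complex.exp ((lam₀ + x : ℝ) * Complex.I) ^ h).re
      + (∑ h ∈ Finset.Ico 1 N, a h * Complex.exp ((lam₀ - x : ℝ) * Complex.I) ^ h).re := by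
  rw [cosPartialSum, add_assoc, ← Complex.add_re, ← Finset.sum_add_distrib, Complex.re_sum,
    Finset.mul_sum]
  congr 1
  refine Finset.sum_congr rfl fun h hh => ?_
  rw [ha h (Finset.mem_Ico.1 hh).1, ← Complex.re_mul_ofReal, ← Complex.re_ofReal_mul]
  congr 1
  rw [← Complex.exp_nat_mul, ← Complex.exp_nat_mul]
  have e1 : Complex.exp (h * ((lam₀ + x : ℝ) * Complex.I))
      = Complex.exp ((lam₀ * h : ℝ) * Complex.I) * Complex.exp (h * x * Complex.I) := by
    rw [← Complex.exp_add]; push_cast; ring_nf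
  have e2 : Complex.exp (h * ((lam₀ - x : ℝ) * Complex.I))
      = Complex.exp ((lam₀ * h : ℝ) * Complex.I) * Complex.exp (-(h * x) * Complex.I) := by
    rw [← Complex.exp_add]; push_cast; ring_nf
  rw [e1, e2]
  push_cast
  rw [Complex.cos]
  ring

/-- The sum of the Fourier series `(2π)⁻¹ ∑ γ(h) e^{ihx}`, with the value `0` at the singularities
`±λ₀`, for `γ(0) = g₀` and `γ(h) = Re (a(h) e^{iλ₀h})`. -/
def fourierDensity (g₀ lam₀ : ℝ) (a : ℕ → ℂ) (x : ℝ) : ℝ :=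
  if x = lam₀ ∨ x = -lam₀ then 0 else
    (2 * Real.pi)⁻¹ * (g₀ + (oscSum a (Complex.exp ((lam₀ + x : ℝ) * Complex.I))).re
      + (oscSum a (Complex.exp ((lam₀ - x : ℝ) * Complex.I))).re)

theorem exp_add_sub_ne_one {lam₀ x : ℝ} (hl : lam₀ ∈ Ioo 0 Real.pi)
    (hx : x ∈ Ioo (-Real.pi) Real.pi) (h1 : x ≠ lam₀) (h2 : x ≠ -lam₀) :
    Complex.exp ((lam₀ + x : ℝ) * Complex.I) ≠ 1 ∧
      Complex.exp ((lam₀ - x : ℝ) * Complex.I) ≠ 1 :=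
  ⟨exp_mul_I_ne_one (fun h => h2 (by linarith)) (by linarith [hl.1, hx.1, Real.pi_pos])
      (by linarith [hl.2, hx.2]),
    exp_mul_I_ne_one (fun h => h1 (by linarith)) (by linarith [hl.1, hl.2, hx.2, Real.pi_pos])
      (by linarith [hl.2, hx.1])⟩

theorem tendsto_cosPartialSum {γ : ℤ → ℝ} {a : ℕ → ℂ} {lam₀ β : ℝ} (hl : lam₀ ∈ Ioo 0 Real.pi)
    (ha : ∀ h : ℕ, 1 ≤ h → γ h = (a h * Complex.exp ((lam₀ * h : ℝ) * Complex.I)).re)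
    (hβ0 : 0 < β) (hbv : PowerBV β a) {x : ℝ} (hx : x ∈ Ioo (-Real.pi) Real.pi)
    (h1 : x ≠ lam₀) (h2 : x ≠ -lam₀) :
    Tendsto (fun N => cosPartialSum γ N x) atTop
      (𝓝 (2 * Real.pi * fourierDensity (γ 0) lam₀ a x)) := by
  obtain ⟨hp, hm⟩ := exp_add_sub_ne_one hl hx h1 h2
  have tp := hbv.tendsto_oscSum hβ0 (Complex.norm_exp_ofReal_mul_I _) hp
  have tm := hbv.tendsto_oscSum hβ0 (Complex.norm_exp_ofReal_mul_I _) hm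
  have hpi : 2 * Real.pi ≠ 0 := by positivity
  rw [fourierDensity, if_neg (by tauto), mul_inv_cancel_left₀ hpi]
  simp only [cosPartialSum_eq ha]
  exact (((Complex.continuous_re.tendsto _).comp tp).const_add _).add
    ((Complex.continuous_re.tendsto _).comp tm)

theorem IsSecondOrderStationary.isSpectralDensity_fourierDensity
    (hX : IsSecondOrderStationary P X) {a : ℕ → ℂ} {lam₀ β : ℝ} (hl : lam₀ ∈ Ioo 0 Real.pi)
    (ha : ∀ h : ℕ, 1 ≤ h →
      acvf P X h = (a h * Complex.exp ((lam₀ * h : ℝ) * Complex.I)).re)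
    (hβ0 : 0 < β) (hβ1 : β < 1) (hbv : PowerBV β a) :
    IsSpectralDensity (acvf P X) (fourierDensity (acvf P X 0) lam₀ a) := by
  obtain ⟨C, hC, hCb⟩ := hbv.exists_norm_partialSum_le hβ0 hβ1
  have hae : ∀ᵐ x ∂volume.restrict (Ioo (-Real.pi) Real.pi),
      x ∈ Ioo (-Real.pi) Real.pi ∧ x ≠ lam₀ ∧ x ≠ -lam₀ := by
    filter_upwards [ae_restrict_mem measurableSet_Ioo,
      ae_restrict_of_ae (Measure.ae_ne volume lam₀),
      ae_restrict_of_ae (Measure.ae_ne volume (-lam₀))] with x h1 h2 h3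
    exact ⟨h1, h2, h3⟩
  set q : ℝ → ℝ := fun x => ‖1 - Complex.exp ((x : ℂ) * Complex.I)‖ ^ (β - 1) with hq
  have hqint : ∀ a b, IntervalIntegrable q volume a b :=
    intervalIntegrable_norm_one_sub_exp_rpow (by linarith) (by linarith)
  have hint : IntegrableOn (fun x => |acvf P X 0| + C * q (lam₀ + x) + C * q (lam₀ - x))
      (Ioo (-Real.pi) Real.pi) := by
    have hle : -Real.pi ≤ Real.pi := by linarith [Real.pi_pos]
    rw [← intervalIntegrable_iff_integrableOn_Ioo_of_le hle]
    have h1 : IntervalIntegrable (fun x => q (lam₀ + x)) volume (-Real.pi) Real.pi := by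
      simpa using (hqint (lam₀ + -Real.pi) (lam₀ + Real.pi)).comp_add_left lam₀
    have h2 : IntervalIntegrable (fun x => q (lam₀ - x)) volume (-Real.pi) Real.pi := by
      simpa using (hqint (lam₀ - -Real.pi) (lam₀ - Real.pi)).comp_sub_left lam₀
    exact (intervalIntegrable_const.add (h1.const_mul C)).add (h2.const_mul C)
  refine isSpectralDensity_of_tendsto_cosPartialSum hX.acvf_neg (fun x hx => ?_) hint
    (fun N => ?_) ?_
  · by_cases h : x = lam₀ ∨ x = -lam₀
    · rw [fourierDensity, if_pos h]
    · push Not at h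
      have := hX.nonneg_of_tendsto (tendsto_cosPartialSum hl ha hβ0 hbv hx h.1 h.2)
      exact nonneg_of_mul_nonneg_right this (by positivity)
  · filter_upwards [hae] with x hx
    obtain ⟨hp, hm⟩ := exp_add_sub_ne_one hl hx.1 hx.2.1 hx.2.2
    rw [cosPartialSum_eq ha]
    refine (abs_add_three _ _ _).trans (add_le_add (add_le_add_right ?_ _) ?_)
    · exact (Complex.abs_re_le_norm _).trans (hCb _ (Complex.norm_exp_ofReal_mul_I _) hp N)
    · exact (Complex.abs_re_le_norm _).trans (hCb _ (Complex.norm_exp_ofReal_mul_I _) hm N)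
  · filter_upwards [hae] with x hx
    exact tendsto_cosPartialSum hl ha hβ0 hbv hx.1 hx.2.1 hx.2.2

/-- Coefficients of smaller order than `h^{s-1}` contribute `o(x^{-s})`. -/
theorem PowerBV.tendsto_rpow_mul_oscSum_zero {β s : ℝ} {a : ℕ → ℂ} (ha : PowerBV β a)
    (hβ0 : 0 < β) (hβ1 : β < 1) (hs : 1 - β < s) {σ : ℝ} (hσ : σ = 1 ∨ σ = -1) :
    Tendsto (fun x : ℝ => ((x ^ s : ℝ) : ℂ) * oscSum a (Complex.exp ((σ * x : ℝ) * Complex.I)))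
      (𝓝[>] 0) (𝓝 0) := by
  obtain ⟨C, hC, hb⟩ := ha.exists_norm_oscSum_le hβ0 hβ1
  have hpi := Real.pi_gt_three
  have hlim : Tendsto (fun x : ℝ => C * (2 / Real.pi) ^ (β - 1) * x ^ (s + (β - 1)))
      (𝓝[>] 0) (𝓝 0) := by
    simpa using (tendsto_rpow_zero (by linarith : 0 < s + (β - 1))).const_mul
      (C * (2 / Real.pi) ^ (β - 1))
  refine squeeze_zero_norm' ?_ hlim
  filter_upwards [Ioo_mem_nhdsGT (zero_lt_one' ℝ)] with x hx
  have habs : |σ * x| = x := by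
    rcases hσ with h | h <;> simp [h, abs_of_pos hx.1]
  have hne : Complex.exp ((σ * x : ℝ) * Complex.I) ≠ 1 := by
    have := abs_lt.1 (habs.trans_lt hx.2)
    refine exp_mul_I_ne_one (fun h => ?_) (by linarith) (by linarith)
    rw [h, abs_zero] at habs
    exact hx.1.ne habs
  have hx0 := hx.1
  have hdist := mul_abs_le_norm_one_sub_exp (x := σ * x) (by rw [habs]; linarith [hx.2])
  rw [habs] at hdist
  rw [norm_mul, Complex.norm_real, Real.norm_of_nonneg (by positivity), Real.rpow_add hx0]
  calc x ^ s * ‖oscSum a (Complex.exp ((σ * x : ℝ) * Complex.I))‖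
      ≤ x ^ s * (C * ‖1 - Complex.exp ((σ * x : ℝ) * Complex.I)‖ ^ (β - 1)) :=
        mul_le_mul_of_nonneg_left (hb _ (Complex.norm_exp_ofReal_mul_I _) hne) (by positivity)
    _ ≤ x ^ s * (C * (2 / Real.pi * x) ^ (β - 1)) := by
        refine mul_le_mul_of_nonneg_left (mul_le_mul_of_nonneg_left ?_ hC) (by positivity)
        exact Real.rpow_le_rpow_of_nonpos (by positivity) hdist (by linarith)
    _ = C * (2 / Real.pi) ^ (β - 1) * (x ^ s * x ^ (β - 1)) := by
        rw [Real.mul_rpow (by positivity) hx0.le]; ring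

theorem oscSum_const_mul_add {β β' : ℝ} {a b : ℕ → ℂ} (c : ℂ) (ha : PowerBV β a) (hβ : 0 < β)
    (hb : PowerBV β' b) (hβ' : 0 < β') {w : ℂ} (hw : ‖w‖ = 1) (hw1 : w ≠ 1) :
    oscSum (fun h => c * a h + b h) w = c * oscSum a w + oscSum b w := by
  refine oscSum_eq ((((ha.tendsto_oscSum hβ hw hw1).const_mul c).add
    (hb.tendsto_oscSum hβ' hw hw1)).congr fun M => ?_)
  rw [Finset.mul_sum, ← Finset.sum_add_distrib]
  exact Finset.sum_congr rfl fun h _ => by ring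

/-- The one-sided limits of `|x - λ₀|^s f(x)` at `λ₀`, from the left for `σ = 1` and from the right
for `σ = -1`. -/
theorem tendsto_rpow_mul_fourierDensity {g₀ lam₀ s β : ℝ} {c : ℂ} {b : ℕ → ℂ}
    (hl : lam₀ ∈ Ioo 0 Real.pi) (hs0 : 0 < s) (hs1 : s < 1) (hb : PowerBV β b)
    (hβ1 : β < 1) (hsβ : 1 - β < s) {σ : ℝ} (hσ : σ = 1 ∨ σ = -1) :
    Tendsto (fun x : ℝ => x ^ s *
      fourierDensity g₀ lam₀ (fun h => c * (((h : ℝ) ^ (s - 1) : ℝ) : ℂ) + b h) (lam₀ - σ * x))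
      (𝓝[>] 0)
      (𝓝 ((2 * Real.pi)⁻¹ * (Real.Gamma s *
        (c * Complex.exp ((σ * (Real.pi * s / 2) : ℝ) * Complex.I)).re))) := by
  have hβ0 : 0 < β := by linarith
  have hpow : PowerBV (1 - s) (fun h => (((h : ℝ) ^ (s - 1) : ℝ) : ℂ)) := by
    simpa using powerBV_rpow_neg (β := 1 - s) (by linarith)
  set a : ℕ → ℂ := fun h => c * (((h : ℝ) ^ (s - 1) : ℝ) : ℂ) + b h with ha_def
  have ha : PowerBV (1 - s) a := (hpow.const_mul c).add (hb.mono (by linarith))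
  have hxs := tendsto_rpow_zero hs0
  -- the constant term
  have t1 : Tendsto (fun x : ℝ => x ^ s * g₀) (𝓝[>] 0) (𝓝 0) := by
    simpa using hxs.mul_const g₀
  -- the sum at the angle `λ₀ + λ` for `λ = λ₀ - σx`, bounded since the angle is near `2λ₀`
  have t2 : Tendsto (fun x : ℝ => x ^ s *
      (oscSum a (Complex.exp ((lam₀ + (lam₀ - σ * x) : ℝ) * Complex.I))).re) (𝓝[>] 0) (𝓝 0) := by
    obtain ⟨C, hC, hCb⟩ := ha.exists_norm_oscSum_le (by linarith) (by linarith)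
    have hne0 : Complex.exp ((lam₀ + (lam₀ - σ * 0) : ℝ) * Complex.I) ≠ 1 :=
      exp_mul_I_ne_one (by linarith [hl.1]) (by linarith [hl.1, Real.pi_pos])
        (by linarith [hl.2])
    have hcont : Tendsto (fun x : ℝ => Complex.exp ((lam₀ + (lam₀ - σ * x) : ℝ) * Complex.I))
        (𝓝[>] 0) (𝓝 (Complex.exp ((lam₀ + (lam₀ - σ * 0) : ℝ) * Complex.I))) :=
      ((by fun_prop : Continuous fun x : ℝ =>
        Complex.exp ((lam₀ + (lam₀ - σ * x) : ℝ) * Complex.I)).tendsto 0).mono_left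
        nhdsWithin_le_nhds
    have hbd := ((hcont.const_sub 1).norm.rpow_const (p := 1 - s - 1)
      (Or.inl (norm_ne_zero_iff.2 (sub_ne_zero.2 hne0.symm)))).const_mul C
    have hz := hxs.mul hbd
    rw [zero_mul] at hz
    refine squeeze_zero_norm' ?_ hz
    filter_upwards [hcont.eventually_ne hne0, self_mem_nhdsWithin] with x hx (hx0 : 0 < x)
    rw [norm_mul, Real.norm_of_nonneg (by positivity)]
    refine mul_le_mul_of_nonneg_left ?_ (by positivity)
    exact (Complex.abs_re_le_norm _).trans (hCb _ (Complex.norm_exp_ofReal_mul_I _) hx)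
  -- the sum at the angle `λ₀ - λ = σx`, which carries the singularity
  have t3 : Tendsto (fun x : ℝ => x ^ s *
      (oscSum a (Complex.exp ((σ * x : ℝ) * Complex.I))).re) (𝓝[>] 0)
      (𝓝 (Real.Gamma s * (c * Complex.exp ((σ * (Real.pi * s / 2) : ℝ) * Complex.I)).re)) := by
    have h1 := ((tendsto_rpow_mul_oscSum_rpow hs0 hs1 hσ).const_mul c).add
      (hb.tendsto_rpow_mul_oscSum_zero hβ0 hβ1 hsβ hσ)
    have h2 := (Complex.continuous_re.tendsto _).comp h1
    rw [add_zero, mul_left_comm, Complex.re_ofReal_mul] at h2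
    refine h2.congr' ?_
    filter_upwards [Ioo_mem_nhdsGT (zero_lt_one' ℝ)] with x hx
    have hpi := Real.pi_gt_three
    have hne : Complex.exp ((σ * x : ℝ) * Complex.I) ≠ 1 := by
      refine exp_mul_I_ne_one ?_ ?_ ?_ <;> rcases hσ with h | h <;> rw [h] <;>
        linarith [hx.1, hx.2]
    rw [Function.comp_apply, oscSum_const_mul_add c hpow (by linarith) hb hβ0
      (Complex.norm_exp_ofReal_mul_I _) hne, ← Complex.re_ofReal_mul]
    congr 1
    ring
  have t := ((t1.add t2).add t3).const_mul (2 * Real.pi)⁻¹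
  rw [add_zero, zero_add] at t
  refine t.congr' ?_
  filter_upwards [Ioo_mem_nhdsGT hl.1] with x hx
  have hne : ¬ (lam₀ - σ * x = lam₀ ∨ lam₀ - σ * x = -lam₀) := by
    rcases hσ with h | h <;> rw [h] <;> rintro (h' | h') <;> linarith [hx.1, hx.2]
  rw [fourierDensity, if_neg hne, sub_sub_cancel]
  ring

/-- One side of the representation of `f` at `λ₀`: the remainder is `x^s f - c`, and `0` beyond the
range `(0, r)` of the variable, so that it is bounded below by `-c` everywhere. -/
theorem exists_remainder {F : ℝ → ℝ} {c s r : ℝ} (hc : 0 ≤ c) (hr : 0 < r)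
    (hF : ∀ x, 0 < x → x < r → 0 ≤ F x)
    (hlim : Tendsto (fun x => x ^ s * F x) (𝓝[>] 0) (𝓝 c)) :
    ∃ R : ℝ → ℝ, (∀ x, 0 < x → -c ≤ R x) ∧ Tendsto R (𝓝[>] 0) (𝓝 0) ∧
      ∀ x, 0 < x → x < r → F x = (c + R x) * x ^ (-s) := by
  classical
  refine ⟨fun x => if x < r then x ^ s * F x - c else 0, fun x hx => ?_, ?_, fun x hx hxr => ?_⟩
  · dsimp only
    split_ifs with h
    · have := mul_nonneg (Real.rpow_nonneg hx.le s) (hF x hx h)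
      linarith
    · linarith
  · have h := hlim.sub_const c
    rw [sub_self] at h
    refine h.congr' ?_
    filter_upwards [Ioo_mem_nhdsGT hr] with x hx
    rw [if_pos hx.2]
  · dsimp only
    rw [if_pos hxr, add_sub_cancel, mul_right_comm, ← Real.rpow_add hx, add_neg_cancel,
      Real.rpow_zero, one_mul]

end CLM

end

theorem propositionC2 {Ω : Type*} [MeasurableSpace Ω] (P : Measure Ω) [IsProbabilityMeasure P]
    (X : ℤ → Ω → ℝ) (hX : CLM.IsSecondOrderStationary P X)
    (lam₀ d cγ φ : ℝ) (R : ℝ → ℝ) (hT : CLM.IsTimeCLM P X lam₀ d cγ φ R)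
    (hφ : φ = (1 / 2 - d) * Real.pi)
    (ε ξ b₁ b₂ : ℝ) (L₁ L₂ : ℝ → ℝ)
    (hε : ε ∈ Ioo 0 d) (hξ : ξ = 1 ∨ ξ = -1)
    (hL₁ : CLM.IsQuasiMonotoneSV L₁) (hL₂ : CLM.IsQuasiMonotoneSV L₂)
    (hb₁ : 0 < b₁)
    (hL₁b : Tendsto L₁ atTop (𝓝 b₁)) (hL₂b : Tendsto (fun x => ξ * L₂ x) atTop (𝓝 b₂))
    (hb : b₂ = 0 ∨ (b₂ ≠ 0 ∧
      b₁ / b₂ ∈ Ioo (-Real.tan (Real.pi * (d - ε))) (Real.tan (Real.pi * (d - ε)))))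
    (hR : ∀ h : ℕ, 1 ≤ h →
      R h = L₁ h * Real.cos (lam₀ * h) * (h : ℝ) ^ (-2 * ε)
        + ξ * L₂ h * Real.sin (lam₀ * h) * (h : ℝ) ^ (-2 * ε)) :
    CLM.IsSpectralCLM P X lam₀ d 0
      (cγ / (2 * Real.pi) * Real.Gamma (2 * d) * Real.sin (2 * Real.pi * d)) := by
  obtain ⟨hl, ⟨hd0, hd1⟩, hc, -, -, hacvf⟩ := hT
  obtain ⟨hε0, hε1⟩ := hε
  have hpi := Real.pi_pos
  have hξ2 : ξ * ξ = 1 := by rcases hξ with h | h <;> rw [h] <;> norm_num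
  have hL₂b' : Tendsto L₂ atTop (𝓝 (ξ * b₂)) :=
    (hL₂b.const_mul ξ).congr fun x => by rw [← mul_assoc, hξ2, one_mul]
  set β : ℝ := 1 - 2 * d + 2 * ε with hβ_def
  have hβ0 : 0 < β := by linarith
  -- `γ(h) = Re (a(h) e^{iλ₀h})`, where `a` is the sum of the leading term and of `b`
  set b : ℕ → ℂ := fun h => ((L₁ h : ℝ) : ℂ) * (((h : ℝ) ^ (-β) : ℝ) : ℂ)
    + -(ξ * Complex.I) * (((L₂ h : ℝ) : ℂ) * (((h : ℝ) ^ (-β) : ℝ) : ℂ)) with hb_def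
  set c : ℂ := cγ * Complex.exp ((φ : ℂ) * Complex.I) with hc_def
  set a : ℕ → ℂ := fun h => c * (((h : ℝ) ^ (2 * d - 1) : ℝ) : ℂ) + b h with ha_def
  have hbBV : CLM.PowerBV β b :=
    (hL₁.powerBV hL₁b hβ0).add ((hL₂.powerBV hL₂b' hβ0).const_mul _)
  have haBV : CLM.PowerBV (1 - 2 * d) a := by
    have hpow := CLM.powerBV_rpow_neg (β := 1 - 2 * d) (by linarith)
    simp only [neg_sub] at hpow
    exact (hpow.const_mul c).add (hbBV.mono (by linarith))
  have ha : ∀ h : ℕ, 1 ≤ h →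
      CLM.acvf P X h = (a h * Complex.exp ((lam₀ * h : ℝ) * Complex.I)).re := by
    intro h hh
    have hh0 : (0 : ℝ) < h := by exact_mod_cast hh
    have hpow : (h : ℝ) ^ (-2 * ε) * (h : ℝ) ^ (2 * d - 1) = (h : ℝ) ^ (-β) := by
      rw [← Real.rpow_add hh0, hβ_def]; ring_nf
    have hsplit : a h * Complex.exp ((lam₀ * h : ℝ) * Complex.I)
        = ((cγ * (h : ℝ) ^ (2 * d - 1) : ℝ) : ℂ)
            * Complex.exp ((lam₀ * h + φ : ℝ) * Complex.I)
          + (((L₁ h * (h : ℝ) ^ (-β) : ℝ) : ℂ) * Complex.exp ((lam₀ * h : ℝ) * Complex.I)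
          + ((ξ * L₂ h * (h : ℝ) ^ (-β) : ℝ) : ℂ)
            * (-Complex.I * Complex.exp ((lam₀ * h : ℝ) * Complex.I))) := by
      have : Complex.exp ((lam₀ * h + φ : ℝ) * Complex.I)
          = Complex.exp ((φ : ℂ) * Complex.I) * Complex.exp ((lam₀ * h : ℝ) * Complex.I) := by
        rw [← Complex.exp_add]; push_cast; ring_nf
      rw [this, ha_def, hb_def, hc_def]
      push_cast
      ring
    rw [hsplit, Complex.add_re, Complex.add_re, Complex.re_ofReal_mul, Complex.re_ofReal_mul,
      Complex.re_ofReal_mul, Complex.exp_ofReal_mul_I_re, Complex.exp_ofReal_mul_I_re,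
      neg_mul, Complex.neg_re, Complex.I_mul_re, Complex.exp_ofReal_mul_I_im, hacvf h hh, hR h hh,
      ← hpow]
    ring
  have hdens := hX.isSpectralDensity_fourierDensity hl ha (by linarith) (by linarith) haBV
  set f := CLM.fourierDensity (CLM.acvf P X 0) lam₀ a with hf_def
  have hval : ∀ σ : ℝ, (c * Complex.exp ((σ * (Real.pi * (2 * d) / 2) : ℝ) * Complex.I)).re
      = cγ * Real.cos (φ + σ * (Real.pi * d)) := by
    intro σ
    rw [hc_def, mul_assoc, ← Complex.exp_add, Complex.re_ofReal_mul,
      ← Complex.exp_ofReal_mul_I_re]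
    push_cast
    ring_nf
  have hleft : Tendsto (fun x : ℝ => x ^ (2 * d) * f (lam₀ - x)) (𝓝[>] 0) (𝓝 0) := by
    have := CLM.tendsto_rpow_mul_fourierDensity (g₀ := CLM.acvf P X 0) (c := c) hl
      (by linarith : 0 < 2 * d) (by linarith) hbBV (by linarith) (by linarith) (Or.inl rfl)
    rw [hval, hφ, show (1 / 2 - d) * Real.pi + 1 * (Real.pi * d) = Real.pi / 2 by ring,
      Real.cos_pi_div_two, mul_zero, mul_zero, mul_zero] at this
    simpa only [one_mul] using this
  have hright : Tendsto (fun x : ℝ => x ^ (2 * d) * f (lam₀ + x)) (𝓝[>] 0)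
      (𝓝 (cγ / (2 * Real.pi) * Real.Gamma (2 * d) * Real.sin (2 * Real.pi * d))) := by
    have := CLM.tendsto_rpow_mul_fourierDensity (g₀ := CLM.acvf P X 0) (c := c) hl
      (by linarith : 0 < 2 * d) (by linarith) hbBV (by linarith) (by linarith) (Or.inr rfl)
    rw [hval, hφ, show (1 / 2 - d) * Real.pi + -1 * (Real.pi * d)
      = Real.pi / 2 - 2 * Real.pi * d by ring, Real.cos_pi_div_two_sub] at this
    convert this using 2
    · rw [neg_one_mul, sub_neg_eq_add]
    · ring
  have hcp : 0 < cγ / (2 * Real.pi) * Real.Gamma (2 * d) * Real.sin (2 * Real.pi * d) := by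
    have h1 := Real.Gamma_pos_of_pos (by linarith : 0 < 2 * d)
    have h2 : 0 < Real.sin (2 * Real.pi * d) :=
      Real.sin_pos_of_pos_of_lt_pi (by positivity) (by nlinarith)
    positivity
  obtain ⟨Rm, hRm1, hRm2, hRm3⟩ := CLM.exists_remainder le_rfl hl.1
    (fun x h1 h2 => hdens.nonneg _ ⟨by linarith [hl.1], by linarith [hl.2]⟩) hleft
  obtain ⟨Rp, hRp1, hRp2, hRp3⟩ := CLM.exists_remainder hcp.le (sub_pos.2 hl.2)
    (fun x h1 h2 => hdens.nonneg _ ⟨by linarith [hl.1], by linarith [hl.2]⟩) hright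
  refine ⟨hl, ⟨hd0, hd1⟩, le_rfl, hcp.le, by linarith, f, hdens, Rm, Rp, hRm1, hRp1, hRm2, hRp2,
    fun x h1 h2 => ?_, fun x h1 h2 => ?_⟩
  · have := hRm3 (lam₀ - x) (by linarith) (by linarith)
    rwa [sub_sub_cancel, ← neg_mul] at this
  · have := hRp3 (x - lam₀) (by linarith) (by linarith)
    rwa [add_sub_cancel, ← neg_mul] at this
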